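/- Let $p,q\ge 0$ be integers with $n:=p+q\ge 2$. Let $S^p\subset\mathbb R^{p+1}$ and $S^q\subset\mathbb R^{q+1}$ be the unit spheres ($S^0=\{\pm1\}$), and give $M=S^p\times S^q$ the pseudo-Riemannian metric $g=-g_{S^p}+g_{S^q}$ of signature $(p,q)$ ($p$ minus signs), induced by the quadratic form $-|y|^2+|z|^2$ on $\mathbb R^{p+1}\times\mathbb R^{q+1}\ni(y,z)$. All Laplacians are $\Delta=-g^{ab}\nabla_a\nabla_b$ of the metric in question; $\Delta_{S^p}$, $\Delta_{S^q}$ are those of the round metrics, acting in the respective variable, and $\Box=\Delta_{\mathbb R^{q+1}}-\Delta_{\mathbb R^{p+1}}$ on the ambient space. Let $S=y\cdot\partial_y$, $R=z\cdot\partial_z$ be the radial vector fields and $X=R+S$. For a smooth $f:M\to\mathbb R$ and $\omega\in\mathbb R$, an extension of $f$ of weight $\omega$ is a function $F$ that is smooth on an open neighbourhood of $M$ in $\mathbb R^{p+1}\times\mathbb R^{q+1}$, with $XF=\omega F$ there and $F|_M=f$. Let $\mathrm{Scal}$, $\rho$ be the scalar and Ricci curvature of $g$, and put $$J=\frac{\mathrm{Scal}}{2(n-1)},\qquad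 V=\frac{\rho-Jg}{n-2},\qquad T=(n-2)J-4V\cdot,\qquad Q=\frac n2J^2-2|V|^2+\Delta J,$$ where $V$, $T$, $Q$ are considered for $n\ge3$ only, $V\cdot$ acts on 1-forms by $(V\cdot\alpha)_a=V_a{}^b\alpha_b$, and $\delta\alpha=-\nabla^a\alpha_a$. Then: 1. $\mathrm{Scal}=(n-1)(q-p)$ and $J=\frac{q-p}2$. 2. For all $u,v\in\mathbb R$, every smooth $f$ on $M$ has an extension $F$ of weight $u+v$ with $SF=uF$ and $RF=vF$ wherever $y\ne0\ne z$. 3. ($m=1$) For every smooth $f$ and every extension $F$ of $f$ of weight $1-\frac n2$, $$(\Box F)|_M=\Delta_{S^q}f-\Delta_{S^p}f-\frac{q-p}2\Big(1-\frac n2\Big)f=\Big(\Delta+\frac{n-2}{4(n-1)}\mathrm{Scal}\Big)f,$$ so $\Box$ restricts to the Yamabe operator of $(M,g)$. 4. ($m=2$) For every smooth $f$ and every extension $F$ of $f$ of weight $2-\frac n2$, with $\kappa=\frac{n-2}{4(n-1)}\mathrm{Scal}$, $$(\Box^2F)|_M=\Big(\Delta_{S^q}^2+\Delta_{S^p}^2-2\Delta_{S^q}\Delta_{S^p}-2(1-\kappa)\Delta_{S^q}+2(-1-\kappa)\Delta_{S^p}+\kappa^2+n-\frac{n^2}2+pq\Big)f.$$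 5. If $n\ge3$, then $|V|^2=\frac n4$, $Q=\frac n2\big(\frac{q-p}2\big)^2-\frac n2$, and for every smooth $f$, $$\delta Td f=(n-2)\frac{q-p}2(\Delta_{S^q}-\Delta_{S^p})f-2(\Delta_{S^q}+\Delta_{S^p})f;$$ and for every extension $F$ of $f$ of weight $2-\frac n2$, $$(\Box^2F)|_M=\Big(\Delta^2+\delta Td+\frac{n-4}2Q\Big)f,$$ so $\Box^2$ restricts to the Paneitz operator of $(M,g)$. -/

import Mathlib

open scoped Manifold ContDiff

noncomputable section

/-!
## Pseudo-Riemannian geometry of a (boundaryless) manifold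

`M` is a manifold modelled on the finite-dimensional space `E` with basis `b`, so that every chart
gives coordinates `u = ∑ uⁱ bᵢ`.  Tensor fields on `M` are families of forms on the tangent spaces.
The value of each operator below at a point `x` is computed by the classical index formula in the
chart `extChartAt I x` around `x`.
-/

namespace PseudoRiem

variable {E : Type*} [NormedAddCommGroup E] [NormedSpace ℝ E]
  {H : Type*} [TopologicalSpace H] (I : ModelWithCorners ℝ E H)
  {M : Type*} [TopologicalSpace M] [ChartedSpace H M]
  {ι : Type*} [Fintype ι] [DecidableEq ι] (b : Module.Basis ι ℝ E)

/-- Fields of bilinear forms (covariant 2-tensors) on `M`; in particular metrics. -/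
abbrev BilinField (M : Type*) [TopologicalSpace M] [ChartedSpace H M] :=
  ∀ x : M, LinearMap.BilinForm ℝ (TangentSpace I x)

/-- Fields of linear forms (1-forms) on `M`. -/
abbrev FormField (M : Type*) [TopologicalSpace M] [ChartedSpace H M] :=
  ∀ x : M, TangentSpace I x →ₗ[ℝ] ℝ

/-- The partial derivative `∂ᵢ φ` in the coordinate space. -/
def pd (i : ι) (φ : E → ℝ) (u : E) : ℝ := fderiv ℝ φ u (b i)

/-- The coordinate vector field `∂ᵢ` of the chart around `x₀`, at the point with coordinates `u`. -/
def coordVec (x₀ : M) (i : ι) (u : E) : TangentSpace I ((extChartAt I x₀).symm u) :=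
  mfderiv 𝓘(ℝ, E) I (extChartAt I x₀).symm u (b i)

/-- The components `αᵢ = α(∂ᵢ)` of a 1-form in the chart around `x₀`. -/
def formComp (α : FormField I M) (x₀ : M) (i : ι) (u : E) : ℝ :=
  α ((extChartAt I x₀).symm u) (coordVec I b x₀ i u)

/-- The components `Tᵢⱼ = T(∂ᵢ, ∂ⱼ)` of a 2-tensor in the chart around `x₀`. -/
def bilinComp (T : BilinField I M) (x₀ : M) (i j : ι) (u : E) : ℝ :=
  T ((extChartAt I x₀).symm u) (coordVec I b x₀ i u) (coordVec I b x₀ j u)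

/-- The inverse metric `gⁱʲ` in the chart around `x₀`. -/
def invMetric (g : BilinField I M) (x₀ : M) (i j : ι) (u : E) : ℝ :=
  (Matrix.of fun k l => bilinComp I b g x₀ k l u)⁻¹ i j

/-- The Christoffel symbols `Γᵏᵢⱼ` of the Levi-Civita connection in the chart around `x₀`. -/
def christoffel (g : BilinField I M) (x₀ : M) (k i j : ι) (u : E) : ℝ :=
  (1 / 2) * ∑ l, invMetric I b g x₀ k l u *
    (pd b i (bilinComp I b g x₀ j l) u + pd b j (bilinComp I b g x₀ i l) u
      - pd b l (bilinComp I b g x₀ i j) u)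

/-- The curvature components `Rˡₖᵢⱼ = dxˡ (R(∂ᵢ, ∂ⱼ) ∂ₖ)`, where
`R(X, Y) = [∇_X, ∇_Y] - ∇_[X, Y]`, in the chart around `x₀`. -/
def riemannComp (g : BilinField I M) (x₀ : M) (l k i j : ι) (u : E) : ℝ :=
  pd b i (christoffel I b g x₀ l j k) u - pd b j (christoffel I b g x₀ l i k) u
    + ∑ m, (christoffel I b g x₀ l i m u * christoffel I b g x₀ m j k u
      - christoffel I b g x₀ l j m u * christoffel I b g x₀ m i k u)

/-- The Ricci components `ρₖⱼ = Rⁱₖᵢⱼ` in the chart around `x₀`. -/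
def ricciComp (g : BilinField I M) (x₀ : M) (k j : ι) (u : E) : ℝ :=
  ∑ i, riemannComp I b g x₀ i k i j u

/-- The differential at `x` of the chart around `x`. -/
def chartDiff (x : M) : TangentSpace I x →ₗ[ℝ] E :=
  (mvfderiv I (extChartAt I x) x).toLinearMap

/-- The linear form on `T_x M` with components `cᵢ` in the chart around `x`. -/
def formOfComp (x : M) (c : ι → ℝ) : TangentSpace I x →ₗ[ℝ] ℝ :=
  (b.constr ℝ c : E →ₗ[ℝ] ℝ) ∘ₗ chartDiff I x

/-- The bilinear form on `T_x M` with components `cᵢⱼ` in the chart around `x`. -/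
def bilinOfComp (x : M) (c : ι → ι → ℝ) : LinearMap.BilinForm ℝ (TangentSpace I x) :=
  (Matrix.toBilin b (Matrix.of c)).comp (chartDiff I x) (chartDiff I x)

/-- The Ricci tensor `ρ`. -/
def ricci (g : BilinField I M) : BilinField I M := fun x =>
  bilinOfComp I b x fun k j => ricciComp I b g x k j (extChartAt I x x)

/-- The trace `gⁱʲ Tᵢⱼ` of a 2-tensor. -/
def trace (g T : BilinField I M) (x : M) : ℝ :=
  ∑ i, ∑ j, invMetric I b g x i j (extChartAt I x x) * bilinComp I b T x i j (extChartAt I x x)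

/-- The squared norm `|T|² = gⁱᵏ gʲˡ Tᵢⱼ Tₖₗ` of a 2-tensor. -/
def normSq (g T : BilinField I M) (x : M) : ℝ :=
  ∑ i, ∑ j, ∑ k, ∑ l,
    invMetric I b g x i k (extChartAt I x x) * invMetric I b g x j l (extChartAt I x x)
      * bilinComp I b T x i j (extChartAt I x x) * bilinComp I b T x k l (extChartAt I x x)

/-- The action `(T · α)ᵢ = Tᵢⱼ gʲᵏ αₖ` of a 2-tensor on 1-forms. -/
def act (g T : BilinField I M) (α : FormField I M) : FormField I M := fun x =>
  formOfComp I b x fun i => ∑ j, ∑ k, bilinComp I b T x i j (extChartAt I x x)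
    * invMetric I b g x j k (extChartAt I x x) * formComp I b α x k (extChartAt I x x)

/-- The differential `d f` of a function. -/
def diff (f : M → ℝ) : FormField I M := fun x => (mvfderiv I f x).toLinearMap

/-- The divergence `δ α = -gⁱʲ ∇ᵢ αⱼ` of a 1-form, with `∇ᵢ αⱼ = ∂ᵢ αⱼ - Γᵏᵢⱼ αₖ`. -/
def codiff (g : BilinField I M) (α : FormField I M) (x : M) : ℝ :=
  -∑ i, ∑ j, invMetric I b g x i j (extChartAt I x x) *
    (pd b i (formComp I b α x j) (extChartAt I x x)
      - ∑ k, christoffel I b g x k i j (extChartAt I x x)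
          * formComp I b α x k (extChartAt I x x))

/-- The Laplacian `Δ f = δ d f = -gⁱʲ ∇ᵢ ∇ⱼ f`. -/
def laplacian (g : BilinField I M) (f : M → ℝ) : M → ℝ := codiff I b g (diff I f)

/-- The scalar curvature. -/
def scal (g : BilinField I M) : M → ℝ := trace I b g (ricci I b g)

/-- The dimension `n`, as a real number. -/
def dim (_b : Module.Basis ι ℝ E) : ℝ := Fintype.card ι

/-- `J = Scal / (2 (n - 1))`. -/
def schoutenJ (g : BilinField I M) (x : M) : ℝ := scal I b g x / (2 * (dim b - 1))

/-- The Schouten tensor `V = (ρ - J g) / (n - 2)`. -/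
def schoutenV (g : BilinField I M) : BilinField I M := fun x =>
  (dim b - 2)⁻¹ • (ricci I b g x - schoutenJ I b g x • g x)

/-- `T = (n - 2) J - 4 V·`, acting on 1-forms. -/
def paneitzT (g : BilinField I M) (α : FormField I M) : FormField I M := fun x =>
  ((dim b - 2) * schoutenJ I b g x) • α x - (4 : ℝ) • act I b g (schoutenV I b g) α x

/-- `Q = (n / 2) J² - 2 |V|² + Δ J`. -/
def paneitzQ (g : BilinField I M) (x : M) : ℝ :=
  dim b / 2 * schoutenJ I b g x ^ 2 - 2 * normSq I b g (schoutenV I b g) x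
    + laplacian I b g (schoutenJ I b g) x

/-- The Yamabe operator `Δ + (n - 2) / (4 (n - 1)) Scal`. -/
def yamabe (g : BilinField I M) (f : M → ℝ) (x : M) : ℝ :=
  laplacian I b g f x + (dim b - 2) / (4 * (dim b - 1)) * scal I b g x * f x

/-- The Paneitz operator `Δ² + δ T d + ((n - 4) / 2) Q`. -/
def paneitz (g : BilinField I M) (f : M → ℝ) (x : M) : ℝ :=
  laplacian I b g (laplacian I b g f) x + codiff I b g (paneitzT I b g (diff I f)) x
    + (dim b - 4) / 2 * paneitzQ I b g x * f x

/-- The pull-back of the Euclidean inner product of `W` under `Φ : M → W`. -/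
def pullbackInner {W : Type*} [NormedAddCommGroup W] [InnerProductSpace ℝ W] (Φ : M → W) :
    BilinField I M := fun x =>
  LinearMap.BilinForm.comp (innerₗ W) (mvfderiv I Φ x).toLinearMap (mvfderiv I Φ x).toLinearMap

end PseudoRiem

/-! ## The product of spheres in its ambient space -/

namespace SphereProduct

/-- The unit sphere `S^n` in `ℝ^(n+1)`. -/
abbrev Sph (n : ℕ) := Metric.sphere (0 : EuclideanSpace ℝ (Fin (n + 1))) 1

/-- The ambient space `ℝ^(p+1) × ℝ^(q+1)`. -/
abbrev Amb (p q : ℕ) := EuclideanSpace ℝ (Fin (p + 1)) × EuclideanSpace ℝ (Fin (q + 1))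

/-- The standard basis of the model space of `S^n`. -/
def sphBasis (n : ℕ) : Module.Basis (Fin n) ℝ (EuclideanSpace ℝ (Fin n)) :=
  (EuclideanSpace.basisFun (Fin n) ℝ).toBasis

/-- The standard basis of the model space of `S^p × S^q`. -/
def prodBasis (p q : ℕ) : Module.Basis (Fin p ⊕ Fin q) ℝ
    (EuclideanSpace ℝ (Fin p) × EuclideanSpace ℝ (Fin q)) :=
  (sphBasis p).prod (sphBasis q)

/-- The round metric of `S^n`. -/
def roundMetric (n : ℕ) : PseudoRiem.BilinField (𝓡 n) (Sph n) :=
  PseudoRiem.pullbackInner (𝓡 n) fun x : Sph n => (x : EuclideanSpace ℝ (Fin (n + 1)))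

/-- The natural metric of signature `(p, q)` (`p` minus signs) of `S^p × S^q`, induced by the
quadratic form `-|y|² + |z|²` of the ambient space. -/
def prodMetric (p q : ℕ) : PseudoRiem.BilinField ((𝓡 p).prod (𝓡 q)) (Sph p × Sph q) := fun θ =>
  PseudoRiem.pullbackInner ((𝓡 p).prod (𝓡 q))
      (fun θ : Sph p × Sph q => (θ.2 : EuclideanSpace ℝ (Fin (q + 1)))) θ
    - PseudoRiem.pullbackInner ((𝓡 p).prod (𝓡 q))
      (fun θ : Sph p × Sph q => (θ.1 : EuclideanSpace ℝ (Fin (p + 1)))) θ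

variable {p q : ℕ}

/-- `Δ_{S^p}`, acting in the first variable. -/
def lapP (f : Sph p × Sph q → ℝ) (θ : Sph p × Sph q) : ℝ :=
  PseudoRiem.laplacian (𝓡 p) (sphBasis p) (roundMetric p) (fun y => f (y, θ.2)) θ.1

/-- `Δ_{S^q}`, acting in the second variable. -/
def lapQ (f : Sph p × Sph q → ℝ) (θ : Sph p × Sph q) : ℝ :=
  PseudoRiem.laplacian (𝓡 q) (sphBasis q) (roundMetric q) (fun z => f (θ.1, z)) θ.2

/-- The inclusion of `S^p × S^q` in the ambient space. -/
def incl (θ : Sph p × Sph q) : Amb p q := (θ.1, θ.2)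

/-- The d'Alembertian `□ = Δ_{ℝ^(q+1)} - Δ_{ℝ^(p+1)}` of the ambient space, where
`Δ = -∑ ∂ᵢ²` is minus Mathlib's Laplacian. -/
def box (F : Amb p q → ℝ) (x : Amb p q) : ℝ :=
  -(Laplacian.laplacian (fun z => F (x.1, z)) : EuclideanSpace ℝ (Fin (q + 1)) → ℝ) x.2
    - -(Laplacian.laplacian (fun y => F (y, x.2)) : EuclideanSpace ℝ (Fin (p + 1)) → ℝ) x.1

/-- The radial vector field `S` of `ℝ^(p+1)`. -/
def radS (F : Amb p q → ℝ) (x : Amb p q) : ℝ := fderiv ℝ F x (x.1, 0)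

/-- The radial vector field `R` of `ℝ^(q+1)`. -/
def radR (F : Amb p q → ℝ) (x : Amb p q) : ℝ := fderiv ℝ F x (0, x.2)

/-- `F` is, near `S^p × S^q`, a smooth extension of `f` with `X F = w F`, where `X = R + S`. -/
def IsExtension (w : ℝ) (f : Sph p × Sph q → ℝ) (F : Amb p q → ℝ) : Prop :=
  (∀ θ, F (incl θ) = f θ) ∧
    ∃ Ω : Set (Amb p q), IsOpen Ω ∧ Set.range (incl (p := p) (q := q)) ⊆ Ω ∧
      ContDiffOn ℝ ∞ F Ω ∧ ∀ x ∈ Ω, radR F x + radS F x = w * F x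

end SphereProduct

end

/-!
All the tensors are computed in the charts of the product of spheres, which are pairs of
stereographic projections centred at the point in question. In such coordinates the metric is
diagonal with the entries `± 16 / (|u|² + 4)²`, where `u` collects the coordinates of the factor
concerned (`IsStereographicAt`). Hence the first derivatives of the metric vanish at the centre,
all operators of second order reduce to flat ones there (`IsStereographicAt.laplacian_eq`,
`IsStereographicAt.codiff_eq`), and the Ricci tensor comes from the linear terms of the Christoffel
symbols (`IsStereographicAt.ricci_basis`). For the product metric the Schouten tensor is half of the
Riemannian product metric (`schoutenV_basis`), so that `T` acts on the components of a 1-form as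
`(n - 2) J - 2 ε`, with the sign `ε` of the respective factor (`formComp_paneitzT`).

The ambient side rests on polar coordinates: if a function `F` is smooth near the unit sphere of
`ℝ^(m+1)`, then the spherical Laplacian of its restriction is the restriction of
`-L F + R² F + (m - 1) R F`, where `L = ∑ ∂ᵢ²` and `R` is the radial vector field
(`laplacian_ambient_eq`, `lapP_smoothFun`, `lapQ_smoothFun`). Write `Dp`, `Dq` for these operators
on the two factors. With `L_p`, `L_q`, `S`, `R` they act on the smooth functions on a neighbourhood
of the product of spheres, subject to `[L_p, S] = 2 L_p`, `[L_q, R] = 2 L_q`, all other commutators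
of `L_p`, `L_q`, `S`, `R` being zero. If `(R + S) F = w F`, these relations express `□ F` and `□² F`
through `Dp`, `Dq` and `S` alone, and the terms with `S` cancel for `w = 1 - n / 2` and
`w = 2 - n / 2`, respectively (`box_identity`, `box_box_identity`). The derivative of `F` normal to
the product of spheres thus plays no role, and restricting gives the explicit formulas. They agree
with the Yamabe and the Paneitz operator since `Δ = Δ_{S^q} - Δ_{S^p}` and the Laplacians of the
factors commute (`paneitz_prodMetric`).

Extensions with prescribed bidegree are `|y|^u |z|^v f(y / |y|, z / |z|)` (`homogExt`).
-/

noncomputable section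

namespace PseudoRiem

/-! ### Tensor components in a globally parametrized chart -/

section Chart

variable {E : Type*} [NormedAddCommGroup E] [NormedSpace ℝ E]
  {H : Type*} [TopologicalSpace H] {I : ModelWithCorners ℝ E H}
  {M : Type*} [TopologicalSpace M] [ChartedSpace H M]
  {ι : Type*} (b : Module.Basis ι ℝ E)

theorem range_eq_univ_of_target_eq_univ {x₀ : M} (ht : (extChartAt I x₀).target = Set.univ) :
    Set.range I = Set.univ := by
  rw [Set.eq_univ_iff_forall]
  intro u
  have h : u ∈ (extChartAt I x₀).target := ht ▸ Set.mem_univ u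
  exact extChartAt_target_subset_range x₀ h

theorem mdifferentiableAt_extChartAt_symm [IsManifold I 1 M] {x₀ : M}
    (ht : (extChartAt I x₀).target = Set.univ) (u : E) :
    MDifferentiableAt 𝓘(ℝ, E) I (extChartAt I x₀).symm u := by
  have h := (contMDiffOn_extChartAt_symm (I := I) (n := 1) x₀) u (ht ▸ Set.mem_univ u)
  rw [ht, contMDiffWithinAt_univ] at h
  exact h.mdifferentiableAt one_ne_zero

/-- The chain rule: along the coordinate vector `∂ᵢ`, the differential of `Φ` is the partial
derivative of the coordinate expression of `Φ`. -/
theorem mvfderiv_coordVec [IsManifold I 1 M] {F : Type*} [NormedAddCommGroup F] [NormedSpace ℝ F]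
    {x₀ : M} (ht : (extChartAt I x₀).target = Set.univ) {Φ : M → F}
    (hΦ : MDifferentiable I 𝓘(ℝ, F) Φ) (i : ι) (u : E) :
    mvfderiv I Φ ((extChartAt I x₀).symm u) (coordVec I b x₀ i u)
      = fderiv ℝ (Φ ∘ (extChartAt I x₀).symm) u (b i) := by
  have h := mfderiv_comp u (hΦ ((extChartAt I x₀).symm u)) (mdifferentiableAt_extChartAt_symm ht u)
  rw [mfderiv_eq_fderiv] at h
  rw [h]
  rfl

theorem formComp_diff [IsManifold I 1 M] {x₀ : M} (ht : (extChartAt I x₀).target = Set.univ)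
    {f : M → ℝ} (hf : MDifferentiable I 𝓘(ℝ, ℝ) f) (i : ι) (u : E) :
    formComp I b (diff I f) x₀ i u = pd b i (f ∘ (extChartAt I x₀).symm) u :=
  mvfderiv_coordVec b ht hf i u

theorem bilinComp_pullbackInner [IsManifold I 1 M] {W : Type*} [NormedAddCommGroup W]
    [InnerProductSpace ℝ W] {x₀ : M} (ht : (extChartAt I x₀).target = Set.univ) {Φ : M → W}
    (hΦ : MDifferentiable I 𝓘(ℝ, W) Φ) (i j : ι) (u : E) :
    bilinComp I b (pullbackInner I Φ) x₀ i j u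
      = inner ℝ (fderiv ℝ (Φ ∘ (extChartAt I x₀).symm) u (b i))
          (fderiv ℝ (Φ ∘ (extChartAt I x₀).symm) u (b j)) := by
  rw [← mvfderiv_coordVec b ht hΦ, ← mvfderiv_coordVec b ht hΦ]
  rfl

/-- The tangent space at `x` is modelled on `E` through the chart around `x`, so the differential
of this chart at `x` is the identity. -/
theorem chartDiff_apply [IsManifold I 1 M] {x : M} (ht : (extChartAt I x).target = Set.univ)
    (v : TangentSpace I x) : chartDiff I x v = (v : E) := by
  have hd : MDifferentiableAt I 𝓘(ℝ, E) (extChartAt I x) x :=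
    mdifferentiableAt_extChartAt (mem_chart_source H x)
  have hw : writtenInExtChartAt I 𝓘(ℝ, E) x (extChartAt I x) = id := by
    funext u
    have hu : u ∈ (extChartAt I x).target := ht ▸ Set.mem_univ u
    exact (extChartAt I x).right_inv hu
  have h : mvfderiv I (extChartAt I x) x = ContinuousLinearMap.id ℝ E := by
    rw [hd.mvfderiv, hw, range_eq_univ_of_target_eq_univ ht, fderivWithin_univ, fderiv_id]
  change mvfderiv I (extChartAt I x) x v = v
  rw [h]
  rfl

/-- At its centre, the coordinate vectors of the chart around `x` are the basis vectors of the
model space. -/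
theorem coordVec_self [IsManifold I 1 M] {x : M} (ht : (extChartAt I x).target = Set.univ)
    (i : ι) : (coordVec I b x i (extChartAt I x x) : E) = b i := by
  have hd := mdifferentiableAt_extChartAt_symm ht (extChartAt I x x)
  have hw : writtenInExtChartAt 𝓘(ℝ, E) I (extChartAt I x x) (extChartAt I x).symm = id := by
    funext u
    have hu : u ∈ (extChartAt I x).target := ht ▸ Set.mem_univ u
    simp only [writtenInExtChartAt, extChartAt_to_inv]
    exact (extChartAt I x).right_inv hu
  change (mfderiv 𝓘(ℝ, E) I (extChartAt I x).symm (extChartAt I x x) : E →L[ℝ] E) (b i) = b i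
  rw [hd.mfderiv, hw]
  simp only [modelWithCornersSelf_coe, Set.range_id, fderivWithin_univ, fderiv_id]
  rfl

theorem bilinComp_self [IsManifold I 1 M] {x : M} (ht : (extChartAt I x).target = Set.univ)
    (T : BilinField I M) (i j : ι) :
    bilinComp I b T x i j (extChartAt I x x) = T x (b i : E) (b j : E) := by
  -- The type of `T y` depends on the base point `y`, so the base point and the arguments are
  -- replaced simultaneously.
  have h : ∀ y : M, y = x → ∀ v w v' w' : E, v = v' → w = w' →
      T y (v : E) (w : E) = T x (v' : E) (w' : E) := by
    rintro _ rfl v w _ _ rfl rfl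
    rfl
  exact h _ (extChartAt_to_inv x) _ _ _ _ (coordVec_self b ht i) (coordVec_self b ht j)

theorem formComp_self [IsManifold I 1 M] {x : M} (ht : (extChartAt I x).target = Set.univ)
    (α : FormField I M) (i : ι) :
    formComp I b α x i (extChartAt I x x) = α x (b i : E) := by
  have h : ∀ y : M, y = x → ∀ v v' : E, v = v' → α y (v : E) = α x (v' : E) := by
    rintro _ rfl v _ rfl
    rfl
  exact h _ (extChartAt_to_inv x) _ _ (coordVec_self b ht i)

theorem formOfComp_apply [Fintype ι] [IsManifold I 1 M] {x : M}
    (ht : (extChartAt I x).target = Set.univ)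
    (c : ι → ℝ) (v : TangentSpace I x) : formOfComp I b x c v = ∑ i, b.repr (v : E) i * c i := by
  have h : ∀ w : E, b.constr ℝ c w = ∑ i, b.repr w i * c i := fun w => by
    simp [Module.Basis.constr_apply_fintype]
  exact (congrArg (b.constr ℝ c) (chartDiff_apply ht v)).trans (h v)

theorem bilinOfComp_basis [Fintype ι] [DecidableEq ι] [IsManifold I 1 M] {x : M}
    (ht : (extChartAt I x).target = Set.univ)
    (c : ι → ι → ℝ) (i j : ι) : bilinOfComp I b x c (b i : E) (b j : E) = c i j := by
  have h : Matrix.toBilin b (Matrix.of c) (b i) (b j) = c i j := by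
    simp [Matrix.toBilin_apply, Finsupp.single_apply]
  exact (congrArg₂ (fun v w : E => Matrix.toBilin b (Matrix.of c) v w)
    (chartDiff_apply ht (b i : E)) (chartDiff_apply ht (b j : E))).trans h

end Chart
/-! ### Curvature in stereographic coordinates -/

section Stereographic

variable {E : Type*} [NormedAddCommGroup E] [NormedSpace ℝ E]
  {H : Type*} [TopologicalSpace H] {I : ModelWithCorners ℝ E H}
  {M : Type*} [TopologicalSpace M] [ChartedSpace H M]
  {ι : Type*} [Fintype ι] {κ : Type*} [DecidableEq κ]

/-- The sum of the squares of those coordinates of `u` that belong to the same factor as the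
`i`-th one, where `s` assigns to each coordinate its factor. -/
def blockSq (b : Module.Basis ι ℝ E) (s : ι → κ) (i : ι) (u : E) : ℝ :=
  ∑ k, if s k = s i then b.repr u k ^ 2 else 0

theorem blockSq_zero (b : Module.Basis ι ℝ E) (s : ι → κ) (i : ι) : blockSq b s i 0 = 0 := by
  simp [blockSq]

theorem blockSq_nonneg (b : Module.Basis ι ℝ E) (s : ι → κ) (i : ι) (u : E) :
    0 ≤ blockSq b s i u :=
  Finset.sum_nonneg fun k _ => by split_ifs <;> positivity

theorem hasFDerivAt_repr (b : Module.Basis ι ℝ E) (k : ι) (u : E) :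
    ∃ L : E →L[ℝ] ℝ, HasFDerivAt (fun u => b.repr u k) L u ∧ ∀ v, L v = b.repr v k := by
  have := b.finiteDimensional_of_finite
  exact ⟨(b.coord k).toContinuousLinearMap, (b.coord k).toContinuousLinearMap.hasFDerivAt,
    fun v => rfl⟩

theorem hasFDerivAt_blockSq (b : Module.Basis ι ℝ E) (s : ι → κ) (i : ι) (u : E) :
    ∃ L : E →L[ℝ] ℝ, HasFDerivAt (blockSq b s i) L u ∧
      ∀ l, L (b l) = if s l = s i then 2 * b.repr u l else 0 := by
  choose L hL hL' using fun k => hasFDerivAt_repr b k u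
  refine ⟨∑ k, if s k = s i then (2 * b.repr u k) • L k else 0, ?_, fun l => ?_⟩
  · refine HasFDerivAt.fun_sum fun k _ => ?_
    split_ifs
    · simpa using (hL k).pow 2
    · exact hasFDerivAt_const _ _
  · rw [sum_apply, Finset.sum_eq_single l]
    · split_ifs <;> simp [hL']
    · intro k _ hk
      split_ifs <;> simp [hL', Ne.symm hk]
    · simp

variable [DecidableEq ι]

/-- The chart around `x₀` is defined by a global parametrization that sends `0` to `x₀`, and in it
`g` is an orthogonal sum of multiples `ε` of round metrics in stereographic coordinates.
The map `s` assigns to each coordinate its factor. -/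
structure IsStereographicAt (I : ModelWithCorners ℝ E H) (b : Module.Basis ι ℝ E)
    (g : BilinField I M) (x₀ : M) (s : ι → κ) (ε : ι → ℝ) : Prop where
  target_eq : (extChartAt I x₀).target = Set.univ
  self_eq : extChartAt I x₀ x₀ = 0
  sign_mul_self : ∀ i, ε i * ε i = 1
  sign_eq : ∀ i j, s i = s j → ε i = ε j
  comp_eq : ∀ i j u, bilinComp I b g x₀ i j u
    = if i = j then ε i * (16 / (blockSq b s i u + 4) ^ 2) else 0

namespace IsStereographicAt

variable {b : Module.Basis ι ℝ E} {g : BilinField I M} {x₀ : M} {s : ι → κ} {ε : ι → ℝ}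

theorem pd_comp (h : IsStereographicAt I b g x₀ s ε) (l i j : ι) (u : E) :
    pd b l (bilinComp I b g x₀ i j) u
      = if i = j then if s l = s i then
          ε i * (16 / (blockSq b s i u + 4) ^ 2) * (-4 / (blockSq b s i u + 4) * b.repr u l)
        else 0 else 0 := by
  rw [show bilinComp I b g x₀ i j = _ from funext (h.comp_eq i j)]
  by_cases hij : i = j
  · obtain ⟨L, hL, hL'⟩ := hasFDerivAt_blockSq b s i u
    have hN : blockSq b s i u + 4 ≠ 0 := by linarith [blockSq_nonneg b s i u]
    have hd : HasDerivAt (fun t : ℝ => ε i * (16 / (t + 4) ^ 2))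
        (ε i * (-32 / (blockSq b s i u + 4) ^ 3)) (blockSq b s i u) := by
      have h1 : HasDerivAt (fun t : ℝ => (t + 4) ^ 2) (2 * (blockSq b s i u + 4))
          (blockSq b s i u) := by
        simpa using ((hasDerivAt_id (blockSq b s i u)).add_const 4).fun_pow 2
      have h2 := ((h1.fun_inv (pow_ne_zero 2 hN)).const_mul 16).const_mul (ε i)
      refine (h2.congr_deriv ?_).congr_of_eventuallyEq ?_
      · field_simp
        ring
      · exact Filter.Eventually.of_forall fun t => by simp [div_eq_mul_inv]
    have hc := hd.comp_hasFDerivAt u hL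
    simp only [pd, if_pos hij]
    -- `hc` is stated for a composition `∘`, which appears unfolded in the goal.
    erw [hc.fderiv]
    simp only [smul_apply, hL', smul_eq_mul]
    split_ifs
    · field_simp
      ring
    · simp
  · simp [pd, hij]

theorem invMetric_eq (h : IsStereographicAt I b g x₀ s ε) (i j : ι) (u : E) :
    invMetric I b g x₀ i j u
      = if i = j then ε i * ((blockSq b s i u + 4) ^ 2 / 16) else 0 := by
  have hm : (Matrix.of fun k l => bilinComp I b g x₀ k l u)
      = Matrix.diagonal fun i => ε i * (16 / (blockSq b s i u + 4) ^ 2) := by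
    ext k l
    simp [h.comp_eq, Matrix.diagonal_apply]
  have hi : (Matrix.of fun k l => bilinComp I b g x₀ k l u)⁻¹
      = Matrix.diagonal fun i => ε i * ((blockSq b s i u + 4) ^ 2 / 16) := by
    rw [hm]
    refine Matrix.inv_eq_right_inv ?_
    rw [Matrix.diagonal_mul_diagonal, ← Matrix.diagonal_one]
    congr 1
    funext i
    have hN : blockSq b s i u + 4 ≠ 0 := by linarith [blockSq_nonneg b s i u]
    have := h.sign_mul_self i
    field_simp
    linear_combination this
  rw [invMetric, hi, Matrix.diagonal_apply]

theorem invMetric_self (h : IsStereographicAt I b g x₀ s ε) (i j : ι) :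
    invMetric I b g x₀ i j (extChartAt I x₀ x₀) = if i = j then ε i else 0 := by
  rw [h.self_eq, h.invMetric_eq, blockSq_zero]
  norm_num

theorem comp_self (h : IsStereographicAt I b g x₀ s ε) (i j : ι) :
    bilinComp I b g x₀ i j (extChartAt I x₀ x₀) = if i = j then ε i else 0 := by
  rw [h.self_eq, h.comp_eq, blockSq_zero]
  norm_num

/-- The Christoffel symbols: those of a conformally flat metric on each factor, and zero for indices
from different factors. -/
theorem christoffel_eq (h : IsStereographicAt I b g x₀ s ε) (k i j : ι) (u : E) :
    christoffel I b g x₀ k i j u = -2 / (blockSq b s k u + 4) *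
      ((if j = k ∧ s i = s k then b.repr u i else 0) + (if i = k ∧ s j = s k then b.repr u j else 0)
        - (if i = j ∧ s i = s k then b.repr u k else 0)) := by
  have hN : blockSq b s k u + 4 ≠ 0 := by linarith [blockSq_nonneg b s k u]
  have hε := h.sign_mul_self k
  rw [christoffel, Finset.sum_eq_single k]
  · rw [h.invMetric_eq, h.pd_comp, h.pd_comp, h.pd_comp, if_pos rfl]
    -- Both sides vanish unless `i` and `k` belong to the same factor, and there the conformal
    -- factors and the signs agree.
    have e3 : (if i = j then if s k = s i then
          ε i * (16 / (blockSq b s i u + 4) ^ 2) * (-4 / (blockSq b s i u + 4) * b.repr u k)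
        else 0 else 0) = if i = j ∧ s i = s k then
          ε k * (16 / (blockSq b s k u + 4) ^ 2) * (-4 / (blockSq b s k u + 4) * b.repr u k)
          else 0 := by
      by_cases hs : s i = s k
      · have : blockSq b s i u = blockSq b s k u := by simp [blockSq, hs]
        simp [hs, this, h.sign_eq i k hs]
      · simp [hs, Ne.symm hs]
    have e1 : ∀ i j, (if j = k then if s i = s j then
          ε j * (16 / (blockSq b s j u + 4) ^ 2) * (-4 / (blockSq b s j u + 4) * b.repr u i)
        else 0 else 0) = if j = k ∧ s i = s k then
          ε k * (16 / (blockSq b s k u + 4) ^ 2) * (-4 / (blockSq b s k u + 4) * b.repr u i)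
          else 0 := by
      intro i j
      by_cases hj : j = k
      · subst hj
        simp
      · simp [hj]
    have c : ∀ t, ε k * (16 / (blockSq b s k u + 4) ^ 2) * (-4 / (blockSq b s k u + 4) * t)
        = ε k * (16 / (blockSq b s k u + 4) ^ 2) * (-4 / (blockSq b s k u + 4)) * t :=
      fun t => by ring
    have key : ε k * ((blockSq b s k u + 4) ^ 2 / 16)
          * (ε k * (16 / (blockSq b s k u + 4) ^ 2) * (-4 / (blockSq b s k u + 4)))
        = -4 / (blockSq b s k u + 4) := by
      field_simp
      linear_combination -hε
    rw [e3, e1 i j, e1 j i, c, c, c, ← mul_ite_zero, ← mul_ite_zero, ← mul_ite_zero, ← mul_add,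
      ← mul_sub, ← mul_assoc (ε k * _), key]
    ring
  · intro l _ hl
    rw [h.invMetric_eq, if_neg (Ne.symm hl), zero_mul]
  · simp

theorem christoffel_self (h : IsStereographicAt I b g x₀ s ε) (k i j : ι) :
    christoffel I b g x₀ k i j (extChartAt I x₀ x₀) = 0 := by
  rw [h.self_eq, h.christoffel_eq]
  simp

theorem pd_christoffel_self (h : IsStereographicAt I b g x₀ s ε) (m k i j : ι) :
    pd b m (christoffel I b g x₀ k i j) (extChartAt I x₀ x₀) = -(1 / 2) *
      ((if j = k ∧ s i = s k then if m = i then 1 else 0 else 0)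
        + (if i = k ∧ s j = s k then if m = j then 1 else 0 else 0)
        - (if i = j ∧ s i = s k then if m = k then 1 else 0 else 0)) := by
  rw [h.self_eq, show christoffel I b g x₀ k i j = _ from funext (h.christoffel_eq k i j)]
  obtain ⟨L, hL, -⟩ := hasFDerivAt_blockSq b s k 0
  have hr : ∀ (P : Prop) [Decidable P] (l : ι), ∃ A : E →L[ℝ] ℝ,
      HasFDerivAt (fun u : E => if P then b.repr u l else 0) A 0 ∧
        A (b m) = if P then if m = l then 1 else 0 else 0 := by
    intro P _ l
    by_cases hP : P
    · obtain ⟨A, hA, hA'⟩ := hasFDerivAt_repr b l 0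
      exact ⟨A, by simpa [hP] using hA, by simp [hP, hA', Finsupp.single_apply]⟩
    · exact ⟨0, by simpa [hP] using hasFDerivAt_const (0 : ℝ) (0 : E), by simp [hP]⟩
  obtain ⟨A₁, hA₁, e₁⟩ := hr (j = k ∧ s i = s k) i
  obtain ⟨A₂, hA₂, e₂⟩ := hr (i = k ∧ s j = s k) j
  obtain ⟨A₃, hA₃, e₃⟩ := hr (i = j ∧ s i = s k) k
  have hN : blockSq b s k 0 + 4 ≠ 0 := by simp [blockSq_zero]
  have hd : DifferentiableAt ℝ (fun u : E => -2 / (blockSq b s k u + 4)) 0 := by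
    have := hL.differentiableAt
    simp only [div_eq_mul_inv]
    exact ((this.add_const 4).fun_inv hN).const_mul (-2)
  have hm := hd.hasFDerivAt.fun_mul ((hA₁.fun_add hA₂).fun_sub hA₃)
  simp only [pd]
  rw [hm.fderiv]
  simp [blockSq_zero, e₁, e₂, e₃]
  ring

/-- At the centre, the Ricci tensor is `(m - 1) δₖⱼ` on a factor of dimension `m`. -/
theorem ricciComp_self (h : IsStereographicAt I b g x₀ s ε) (k j : ι) :
    ricciComp I b g x₀ k j (extChartAt I x₀ x₀)
      = if k = j then (∑ i, if s i = s j then 1 else 0) - 1 else 0 := by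
  have hr : ∀ i, riemannComp I b g x₀ i k i j (extChartAt I x₀ x₀)
      = if k = j then (if s i = s j then 1 else 0) - (if i = j then 1 else 0) else 0 := by
    intro i
    rw [riemannComp, h.pd_christoffel_self, h.pd_christoffel_self]
    simp only [h.christoffel_self, mul_zero, sub_zero, Finset.sum_const_zero, add_zero]
    by_cases hkj : k = j
    · subst hkj
      by_cases hik : i = k
      · subst hik
        simp
      · have hki : ¬ k = i := fun h => hik h.symm
        by_cases hs : s i = s k
        · simp [hs, hik, hki]
          norm_num
        · have hs' : ¬ s k = s i := fun h => hs h.symm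
          simp [hs, hs', hik, hki]
    · have hjk : ¬ j = k := fun h => hkj h.symm
      by_cases hik : i = k
      · subst hik
        simp [hkj, hjk]
      · have hki : ¬ k = i := fun h => hik h.symm
        simp [hkj, hjk, hik, hki]
  rw [ricciComp, Finset.sum_congr rfl fun i _ => hr i]
  by_cases hkj : k = j
  · simp [hkj]
  · simp [hkj]

/-- At the centre the Christoffel symbols vanish, so the divergence is the flat one. -/
theorem codiff_eq (h : IsStereographicAt I b g x₀ s ε) (α : FormField I M) :
    codiff I b g α x₀ = -∑ i, ε i * pd b i (formComp I b α x₀ i) 0 := by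
  rw [codiff]
  congr 1
  refine Finset.sum_congr rfl fun i _ => ?_
  rw [Finset.sum_eq_single i]
  · simp only [h.christoffel_self, h.invMetric_self]
    simp only [h.self_eq]
    simp
  · intro j _ hj
    rw [h.invMetric_self, if_neg (Ne.symm hj), zero_mul]
  · simp

theorem laplacian_eq [IsManifold I 1 M] (h : IsStereographicAt I b g x₀ s ε) {f : M → ℝ}
    (hf : MDifferentiable I 𝓘(ℝ, ℝ) f) :
    laplacian I b g f x₀
      = -∑ i, ε i * pd b i (pd b i (f ∘ (extChartAt I x₀).symm)) 0 := by
  rw [laplacian, h.codiff_eq]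
  simp only [show ∀ i, formComp I b (diff I f) x₀ i = pd b i (f ∘ (extChartAt I x₀).symm) from
    fun i => funext fun u => formComp_diff b h.target_eq hf i u]

theorem trace_eq (h : IsStereographicAt I b g x₀ s ε) (T : BilinField I M) :
    trace I b g T x₀ = ∑ i, ε i * bilinComp I b T x₀ i i (extChartAt I x₀ x₀) := by
  simp only [trace, h.invMetric_self]
  simp

theorem normSq_eq (h : IsStereographicAt I b g x₀ s ε) (T : BilinField I M) :
    normSq I b g T x₀
      = ∑ i, ∑ j, ε i * ε j * bilinComp I b T x₀ i j (extChartAt I x₀ x₀) ^ 2 := by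
  simp only [normSq, h.invMetric_self]
  refine Finset.sum_congr rfl fun i _ => Finset.sum_congr rfl fun j _ => ?_
  rw [Finset.sum_eq_single i, Finset.sum_eq_single j]
  · simp
    ring
  · intro l _ hl
    simp [Ne.symm hl]
  · simp
  · intro k _ hk
    simp [Ne.symm hk]
  · simp

theorem ricci_basis [IsManifold I 1 M] (h : IsStereographicAt I b g x₀ s ε) (k j : ι) :
    ricci I b g x₀ (b k : E) (b j : E)
      = if k = j then (∑ i, if s i = s j then 1 else 0) - 1 else 0 := by
  rw [← h.ricciComp_self]
  exact bilinOfComp_basis b h.target_eq _ k j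

theorem scal_eq [IsManifold I 1 M] (h : IsStereographicAt I b g x₀ s ε) :
    scal I b g x₀ = ∑ j, ε j * ((∑ i, if s i = s j then 1 else 0) - 1) := by
  rw [scal, h.trace_eq]
  refine Finset.sum_congr rfl fun j _ => ?_
  rw [bilinComp_self b h.target_eq, h.ricci_basis, if_pos rfl]

end IsStereographicAt
end Stereographic
end PseudoRiem

namespace SphereProduct

open PseudoRiem

/-! ### Stereographic parametrization of the sphere -/

section Stereo

variable {V W : Type*} [NormedAddCommGroup V] [InnerProductSpace ℝ V]
  [NormedAddCommGroup W] [InnerProductSpace ℝ W]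

/-- The inverse of the stereographic projection of the unit sphere of `W` from `-x`, where `e`
embeds the parameter space isometrically into `W`, as the orthogonal complement of `x`. -/
def stereoParam (e : V →ₗᵢ[ℝ] W) (x : W) (u : V) : W :=
  (‖u‖ ^ 2 + 4)⁻¹ • ((4 : ℝ) • e u + (4 - ‖u‖ ^ 2) • x)

variable (e : V →ₗᵢ[ℝ] W) (x : W)

theorem stereoParam_zero : stereoParam e x 0 = x := by
  simp [stereoParam]

theorem contDiff_stereoParam {m : ℕ∞ω} : ContDiff ℝ m (stereoParam e x) := by
  have h₀ : ContDiff ℝ m fun u : V => ‖u‖ ^ 2 := contDiff_norm_sq ℝ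
  refine ((h₀.add contDiff_const).inv fun u => by positivity).smul ?_
  exact (contDiff_const.smul e.toContinuousLinearMap.contDiff).add
    ((contDiff_const.sub h₀).smul contDiff_const)

theorem fderiv_stereoParam (u a : V) :
    fderiv ℝ (stereoParam e x) u a = (4 * (‖u‖ ^ 2 + 4)⁻¹) • e a
      - (2 * inner ℝ u a * ((‖u‖ ^ 2 + 4)⁻¹) ^ 2) • ((4 : ℝ) • e u + (8 : ℝ) • x) := by
  have hs : ‖u‖ ^ 2 + 4 ≠ 0 := by positivity
  have h₀ := (hasStrictFDerivAt_norm_sq u).hasFDerivAt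
  have h₁ := (hasDerivAt_inv hs).comp_hasFDerivAt u (h₀.add_const 4)
  have h₂ := ((e.toContinuousLinearMap.hasFDerivAt (x := u)).const_smul (4 : ℝ)).add
    ((h₀.const_sub 4).smul_const x)
  have h₃ := (h₁.smul h₂).fderiv
  have h₄ : fderiv ℝ (stereoParam e x) u a = _ := congrArg (fun L => L a) h₃
  rw [h₄]
  simp
  match_scalars <;> field_simp
  ring

/-- The parametrization is conformal. -/
theorem inner_fderiv_stereoParam (hx : ‖x‖ = 1) (hex : ∀ a, inner ℝ (e a) x = 0) (u a c : V) :
    inner ℝ (fderiv ℝ (stereoParam e x) u a) (fderiv ℝ (stereoParam e x) u c)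
      = 16 / (‖u‖ ^ 2 + 4) ^ 2 * inner ℝ a c := by
  have hs : ‖u‖ ^ 2 + 4 ≠ 0 := by positivity
  have hxe : ∀ a, inner ℝ x (e a) = 0 := fun a => by rw [real_inner_comm, hex]
  rw [fderiv_stereoParam, fderiv_stereoParam]
  simp only [inner_sub_left, inner_sub_right, inner_add_left, inner_add_right, inner_smul_left,
    inner_smul_right, e.inner_map_map, hex, hxe, real_inner_self_eq_norm_sq, hx,
    real_inner_comm u a]
  simp
  field_simp
  ring

/-- The second derivatives of the parametrization at its centre `x` are normal to the sphere. -/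
theorem fderiv_fderiv_stereoParam_zero (a c : V) :
    fderiv ℝ (fun u => fderiv ℝ (stereoParam e x) u a) 0 c = -inner ℝ c a • x := by
  have h₀ := (hasStrictFDerivAt_norm_sq (0 : V)).hasFDerivAt
  have h₁ := (hasDerivAt_inv (x := ‖(0 : V)‖ ^ 2 + 4) (by simp)).comp_hasFDerivAt (0 : V)
    (h₀.add_const 4)
  have hi : HasFDerivAt (fun u : V => inner ℝ u a) (innerSL ℝ a) 0 := by
    have := (innerSL ℝ a).hasFDerivAt (x := (0 : V))
    refine this.congr_of_eventuallyEq (Filter.Eventually.of_forall fun u => ?_)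
    exact (real_inner_comm _ _)
  have h₂ := (h₁.const_mul 4).smul_const (e a)
  have h₃ := ((hi.const_mul 2).mul (h₁.pow 2)).smul
    (((e.toContinuousLinearMap.hasFDerivAt (x := (0 : V))).const_smul (4 : ℝ)).add_const
      ((8 : ℝ) • x))
  have h₄ := (h₂.sub h₃).congr_of_eventuallyEq
    (f₁ := fun u => fderiv ℝ (stereoParam e x) u a)
    (Filter.Eventually.of_forall fun u => fderiv_stereoParam e x u a)
  rw [h₄.fderiv]
  simp
  rw [real_inner_comm]
  match_scalars
  ring

/-- In stereographic coordinates, the second derivatives of `F` at the centre differ from the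
ambient ones by a multiple of the radial derivative, since the parametrization is curved. -/
theorem fderiv_fderiv_comp_stereoParam_zero {F : W → ℝ} (hF : ContDiffAt ℝ ∞ F x) (a : V) :
    fderiv ℝ (fun u => fderiv ℝ (F ∘ stereoParam e x) u a) 0 a
      = fderiv ℝ (fderiv ℝ F) x (e a) (e a) - ‖a‖ ^ 2 * fderiv ℝ F x x := by
  have hψ := contDiff_stereoParam e x (m := ∞)
  have hψd : Differentiable ℝ (stereoParam e x) := hψ.differentiable (by simp)
  have hev : ∀ᶠ u in nhds (0 : V), DifferentiableAt ℝ F (stereoParam e x u) := by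
    have h1 : ∀ᶠ y in nhds x, ContDiffAt ℝ 1 F y :=
      (hF.of_le (by simp : (1 : ℕ∞ω) ≤ ∞)).eventually (by simp)
    have hc : Filter.Tendsto (stereoParam e x) (nhds 0) (nhds x) := by
      have := hψ.continuous.tendsto (0 : V)
      rwa [stereoParam_zero] at this
    exact (hc.eventually h1).mono fun u hu => hu.differentiableAt one_ne_zero
  have he : (fun u => fderiv ℝ (F ∘ stereoParam e x) u a) =ᶠ[nhds 0]
      fun u => fderiv ℝ F (stereoParam e x u) (fderiv ℝ (stereoParam e x) u a) := by
    filter_upwards [hev] with u hu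
    rw [fderiv_comp u hu (hψd u)]
    rfl
  rw [he.fderiv_eq]
  have hF2 : DifferentiableAt ℝ (fderiv ℝ F) (stereoParam e x 0) := by
    rw [stereoParam_zero]
    exact (hF.fderiv_right (m := ∞) le_rfl).differentiableAt (by simp)
  have h1 := hF2.hasFDerivAt.comp (0 : V) (hψd 0).hasFDerivAt
  have h2 : DifferentiableAt ℝ (fun u => fderiv ℝ (stereoParam e x) u a) 0 :=
    (((hψ.fderiv_right (m := ∞) le_rfl).differentiable (by simp)).clm_apply
      (differentiable_const a)) 0
  have h3 := (h1.clm_apply h2.hasFDerivAt).fderiv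
  have h4 := congrArg (fun L => L a) h3
  refine h4.trans ?_
  have h5 : fderiv ℝ (stereoParam e x) 0 a = e a := by
    rw [fderiv_stereoParam]
    simp
  simp [fderiv_fderiv_stereoParam_zero, h5, stereoParam_zero]
  ring

end Stereo

/-! ### The round sphere and its Laplacian -/

section Sphere

instance isManifold_sph (n : ℕ) (m : ℕ∞ω) : IsManifold (𝓡 n) m (Sph n) := .of_le (n := ω) le_top

variable {n : ℕ}

theorem extChartAt_target_sph (x : Sph n) : (extChartAt (𝓡 n) x).target = Set.univ := by
  have := Fact.mk (@finrank_euclideanSpace_fin ℝ _ (n + 1))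
  have h : (extChartAt (𝓡 n) x).target = (stereographic' n (-x)).target := by
    simp only [mfld_simps]
    rfl
  rw [h, stereographic'_target]

theorem extChartAt_self_sph (x : Sph n) : extChartAt (𝓡 n) x x = 0 := by
  have := Fact.mk (@finrank_euclideanSpace_fin ℝ _ (n + 1))
  change (OrthonormalBasis.fromOrthogonalSpanSingleton n (ne_zero_of_mem_unit_sphere (-x))).repr
    (stereographic (norm_eq_of_mem_sphere (-x)) x) = 0
  rw [stereographic_neg_apply]
  exact map_zero _

/-- The charts of the sphere are stereographic: the chart around `x` projects from `-x`. -/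
theorem exists_extChartAt_symm_eq_stereoParam (x : Sph n) :
    ∃ e : EuclideanSpace ℝ (Fin n) →ₗᵢ[ℝ] EuclideanSpace ℝ (Fin (n + 1)),
      (∀ u, inner ℝ (e u) (x : EuclideanSpace ℝ (Fin (n + 1))) = 0) ∧
      ∀ u, ((extChartAt (𝓡 n) x).symm u : EuclideanSpace ℝ (Fin (n + 1)))
        = stereoParam e x u := by
  have := Fact.mk (@finrank_euclideanSpace_fin ℝ _ (n + 1))
  let U : (Submodule.span ℝ {((-x : Sph n) : EuclideanSpace ℝ (Fin (n + 1)))})ᗮ ≃ₗᵢ[ℝ]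
      EuclideanSpace ℝ (Fin n) :=
    (OrthonormalBasis.fromOrthogonalSpanSingleton n (ne_zero_of_mem_unit_sphere (-x))).repr
  refine ⟨(Submodule.subtypeₗᵢ _).comp U.symm.toLinearIsometry, fun u => ?_, fun u => ?_⟩
  · have := Submodule.mem_orthogonal_singleton_iff_inner_left.1 (U.symm u).2
    have h : inner ℝ (U.symm u).1 (-x.1) = 0 := this
    rwa [inner_neg_right, neg_eq_zero] at h
  · have h : ((extChartAt (𝓡 n) x).symm u) = (stereographic' n (-x)).symm u := rfl
    rw [h, stereographic'_symm_apply]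
    simp only [stereoParam, coe_neg_sphere]
    change (‖(U.symm u : EuclideanSpace ℝ (Fin (n + 1)))‖ ^ 2 + 4)⁻¹ • (4 : ℝ) • (U.symm u).1
      + (‖(U.symm u : EuclideanSpace ℝ (Fin (n + 1)))‖ ^ 2 + 4)⁻¹ •
        (‖(U.symm u : EuclideanSpace ℝ (Fin (n + 1)))‖ ^ 2 - 4) • -x.1
      = (‖u‖ ^ 2 + 4)⁻¹ • ((4 : ℝ) • (U.symm u).1 + (4 - ‖u‖ ^ 2) • x.1)
    rw [Submodule.norm_coe, U.symm.norm_map]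
    module

theorem contMDiff_coe_sph {m : ℕ∞ω} :
    ContMDiff (𝓡 n) 𝓘(ℝ, EuclideanSpace ℝ (Fin (n + 1))) m
      fun y : Sph n => (y : EuclideanSpace ℝ (Fin (n + 1))) := by
  have := Fact.mk (@finrank_euclideanSpace_fin ℝ _ (n + 1))
  exact contMDiff_coe_sphere

theorem mdifferentiable_coe_sph :
    MDifferentiable (𝓡 n) 𝓘(ℝ, EuclideanSpace ℝ (Fin (n + 1)))
      fun y : Sph n => (y : EuclideanSpace ℝ (Fin (n + 1))) :=
  contMDiff_coe_sph.mdifferentiable one_ne_zero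

theorem mdifferentiable_of_ambient {F : EuclideanSpace ℝ (Fin (n + 1)) → ℝ}
    (hF : ∀ y : Sph n, ContDiffAt ℝ ∞ F y) :
    MDifferentiable (𝓡 n) 𝓘(ℝ, ℝ) fun y : Sph n => F y :=
  fun y => ((hF y).differentiableAt (by simp)).mdifferentiableAt.comp y
    (mdifferentiable_coe_sph y)

theorem blockSq_sphBasis (i : Fin n) (u : EuclideanSpace ℝ (Fin n)) :
    blockSq (sphBasis n) (fun _ : Fin n => ()) i u = ‖u‖ ^ 2 := by
  simp [blockSq, sphBasis, EuclideanSpace.norm_sq_eq]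

theorem inner_sphBasis (i j : Fin n) :
    inner ℝ (sphBasis n i) (sphBasis n j) = if i = j then (1 : ℝ) else 0 := by
  simpa [sphBasis] using orthonormal_iff_ite.1 (EuclideanSpace.basisFun (Fin n) ℝ).orthonormal i j

/-- The round metric in stereographic coordinates. -/
theorem inner_fderiv_extChartAt_symm (x : Sph n) (u a c : EuclideanSpace ℝ (Fin n)) :
    inner ℝ
        (fderiv ℝ ((fun y : Sph n => (y : EuclideanSpace ℝ (Fin (n + 1)))) ∘
          (extChartAt (𝓡 n) x).symm) u a)
        (fderiv ℝ ((fun y : Sph n => (y : EuclideanSpace ℝ (Fin (n + 1)))) ∘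
          (extChartAt (𝓡 n) x).symm) u c)
      = 16 / (‖u‖ ^ 2 + 4) ^ 2 * inner ℝ a c := by
  obtain ⟨e, he, hψ⟩ := exists_extChartAt_symm_eq_stereoParam x
  rw [show (fun y : Sph n => (y : EuclideanSpace ℝ (Fin (n + 1)))) ∘ (extChartAt (𝓡 n) x).symm
    = stereoParam e x from funext hψ]
  exact inner_fderiv_stereoParam e _ (norm_eq_of_mem_sphere x) he u a c

theorem isStereographicAt_roundMetric (x : Sph n) :
    IsStereographicAt (𝓡 n) (sphBasis n) (roundMetric n) x (fun _ => ()) fun _ => 1 where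
  target_eq := extChartAt_target_sph x
  self_eq := extChartAt_self_sph x
  sign_mul_self _ := one_mul 1
  sign_eq _ _ _ := rfl
  comp_eq i j u := by
    rw [roundMetric, bilinComp_pullbackInner _ (extChartAt_target_sph x) mdifferentiable_coe_sph,
      inner_fderiv_extChartAt_symm, inner_sphBasis, blockSq_sphBasis]
    simp

/-- The Laplacian of the unit sphere in terms of the derivatives, in the ambient space, of an
extension `F`. -/
theorem laplacian_ambient_eq {F : EuclideanSpace ℝ (Fin (n + 1)) → ℝ}
    (hF : ∀ y : Sph n, ContDiffAt ℝ ∞ F y) (x : Sph n) :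
    (Laplacian.laplacian F : EuclideanSpace ℝ (Fin (n + 1)) → ℝ) x
      = -laplacian (𝓡 n) (sphBasis n) (roundMetric n) (fun y : Sph n => F y) x
        + fderiv ℝ (fderiv ℝ F) x x x + n * fderiv ℝ F x x := by
  obtain ⟨e, he, hψ⟩ := exists_extChartAt_symm_eq_stereoParam x
  have hx : ‖(x : EuclideanSpace ℝ (Fin (n + 1)))‖ = 1 := norm_eq_of_mem_sphere x
  have hl : laplacian (𝓡 n) (sphBasis n) (roundMetric n) (fun y : Sph n => F y) x
      = -∑ i, (fderiv ℝ (fderiv ℝ F) x (e (sphBasis n i)) (e (sphBasis n i))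
        - fderiv ℝ F x x) := by
    rw [(isStereographicAt_roundMetric x).laplacian_eq (mdifferentiable_of_ambient hF),
      show (fun y : Sph n => F y) ∘ (extChartAt (𝓡 n) x).symm = F ∘ stereoParam e x from
        funext fun u => congrArg F (hψ u)]
    refine congrArg _ (Finset.sum_congr rfl fun i _ => ?_)
    have h1 : ‖sphBasis n i‖ ^ 2 = 1 := by
      rw [← real_inner_self_eq_norm_sq, inner_sphBasis, if_pos rfl]
    have h2 := fderiv_fderiv_comp_stereoParam_zero e (x : EuclideanSpace ℝ (Fin (n + 1))) (hF x)
      (sphBasis n i)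
    rw [h1] at h2
    rw [one_mul, ← one_mul (fderiv ℝ F x x), ← h2]
    rfl
  -- The ambient Laplacian is computed in an orthonormal basis that consists of `x` and of tangent
  -- vectors of the sphere.
  let v : Option (Fin n) → EuclideanSpace ℝ (Fin (n + 1)) :=
    fun o => o.elim x fun i => e (sphBasis n i)
  have hv : Orthonormal ℝ v := by
    rw [orthonormal_iff_ite]
    rintro (_ | i) (_ | j)
    · simp [v, hx]
    · simp [v, real_inner_comm (e _), he]
    · simp [v, he]
    · simp [v, inner_sphBasis]
  have hc : Module.finrank ℝ (EuclideanSpace ℝ (Fin (n + 1))) = Fintype.card (Option (Fin n)) := by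
    simp
  obtain ⟨B, hB⟩ := Orthonormal.exists_orthonormalBasis_extension_of_card_eq hc
    (v := v) (s := Set.univ) (hv.comp _ Subtype.val_injective)
  rw [hl, InnerProductSpace.laplacian_eq_iteratedFDeriv_orthonormalBasis F B]
  simp only [Fintype.sum_option, iteratedFDeriv_two_apply, hB _ (Set.mem_univ _)]
  simp [v]
  ring

end Sphere
end SphereProduct

/-! ### The product metric and its curvature -/

namespace PseudoRiem

theorem contDiff_comp_extChartAt_symm {E : Type*} [NormedAddCommGroup E] [NormedSpace ℝ E]
    {H : Type*} [TopologicalSpace H] {I : ModelWithCorners ℝ E H}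
    {M : Type*} [TopologicalSpace M] [ChartedSpace H M] [IsManifold I ∞ M]
    {F : Type*} [NormedAddCommGroup F] [NormedSpace ℝ F] {x₀ : M}
    (ht : (extChartAt I x₀).target = Set.univ) {f : M → F} (hf : ContMDiff I 𝓘(ℝ, F) ∞ f) :
    ContDiff ℝ ∞ (f ∘ (extChartAt I x₀).symm) := by
  have h := contMDiffOn_extChartAt_symm (I := I) (n := ∞) x₀
  rw [ht, contMDiffOn_univ] at h
  exact (hf.comp h).contDiff

end PseudoRiem

namespace SphereProduct

open PseudoRiem

variable {p q : ℕ}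

/-- The sign that the metric of `S^p × S^q` has in each coordinate direction. -/
def signs (p q : ℕ) : Fin p ⊕ Fin q → ℝ := Sum.elim (fun _ => -1) fun _ => 1

theorem prodBasis_inl (i : Fin p) : prodBasis p q (Sum.inl i) = (sphBasis p i, 0) := by
  simp [prodBasis]

theorem prodBasis_inr (i : Fin q) : prodBasis p q (Sum.inr i) = (0, sphBasis q i) := by
  simp [prodBasis]

theorem extChartAt_target_prod (θ : Sph p × Sph q) :
    (extChartAt ((𝓡 p).prod (𝓡 q)) θ).target = Set.univ := by
  rw [extChartAt_prod, PartialEquiv.prod_target, extChartAt_target_sph, extChartAt_target_sph,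
    Set.univ_prod_univ]

theorem extChartAt_self_prod (θ : Sph p × Sph q) : extChartAt ((𝓡 p).prod (𝓡 q)) θ θ = 0 := by
  rw [extChartAt_prod]
  exact Prod.ext (extChartAt_self_sph θ.1) (extChartAt_self_sph θ.2)

theorem extChartAt_symm_prod (θ : Sph p × Sph q)
    (u : EuclideanSpace ℝ (Fin p) × EuclideanSpace ℝ (Fin q)) :
    (extChartAt ((𝓡 p).prod (𝓡 q)) θ).symm u
      = ((extChartAt (𝓡 p) θ.1).symm u.1, (extChartAt (𝓡 q) θ.2).symm u.2) := by
  rw [extChartAt_prod]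
  rfl

theorem extChartAt_symm_zero_sph {n : ℕ} (x : Sph n) : (extChartAt (𝓡 n) x).symm 0 = x := by
  conv_lhs => rw [← extChartAt_self_sph x]
  exact extChartAt_to_inv x

/-- The product metric in a pair of stereographic charts. -/
theorem bilinComp_prodMetric (θ : Sph p × Sph q) (i j : Fin p ⊕ Fin q)
    (u : EuclideanSpace ℝ (Fin p) × EuclideanSpace ℝ (Fin q)) :
    bilinComp ((𝓡 p).prod (𝓡 q)) (prodBasis p q) (prodMetric p q) θ i j u
      = 16 / (‖u.2‖ ^ 2 + 4) ^ 2 * inner ℝ (prodBasis p q i).2 (prodBasis p q j).2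
        - 16 / (‖u.1‖ ^ 2 + 4) ^ 2 * inner ℝ (prodBasis p q i).1 (prodBasis p q j).1 := by
  have h1 : bilinComp ((𝓡 p).prod (𝓡 q)) (prodBasis p q) (prodMetric p q) θ i j u
    = bilinComp ((𝓡 p).prod (𝓡 q)) (prodBasis p q) (pullbackInner ((𝓡 p).prod (𝓡 q))
        (fun θ : Sph p × Sph q => (θ.2 : EuclideanSpace ℝ (Fin (q + 1))))) θ i j u
      - bilinComp ((𝓡 p).prod (𝓡 q)) (prodBasis p q) (pullbackInner ((𝓡 p).prod (𝓡 q))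
        (fun θ : Sph p × Sph q => (θ.1 : EuclideanSpace ℝ (Fin (p + 1))))) θ i j u := rfl
  have hd : ∀ {n : ℕ} (x : Sph n), Differentiable ℝ
      ((fun y : Sph n => (y : EuclideanSpace ℝ (Fin (n + 1)))) ∘ (extChartAt (𝓡 n) x).symm) :=
    fun x => (contDiff_comp_extChartAt_symm (extChartAt_target_sph x)
      contMDiff_coe_sph).differentiable (by simp)
  have e2 : ∀ a, fderiv ℝ ((fun θ : Sph p × Sph q => (θ.2 : EuclideanSpace ℝ (Fin (q + 1)))) ∘
      (extChartAt ((𝓡 p).prod (𝓡 q)) θ).symm) u a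
      = fderiv ℝ ((fun y : Sph q => (y : EuclideanSpace ℝ (Fin (q + 1)))) ∘
        (extChartAt (𝓡 q) θ.2).symm) u.2 a.2 := by
    intro a
    have h : (fun θ : Sph p × Sph q => (θ.2 : EuclideanSpace ℝ (Fin (q + 1)))) ∘
        (extChartAt ((𝓡 p).prod (𝓡 q)) θ).symm
        = ((fun y : Sph q => (y : EuclideanSpace ℝ (Fin (q + 1)))) ∘
          (extChartAt (𝓡 q) θ.2).symm) ∘ Prod.snd :=
      funext fun v => by simp only [Function.comp_apply, extChartAt_symm_prod]
    rw [h, fderiv_comp u (hd θ.2 u.2) differentiableAt_snd, fderiv_snd]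
    rfl
  have e1 : ∀ a, fderiv ℝ ((fun θ : Sph p × Sph q => (θ.1 : EuclideanSpace ℝ (Fin (p + 1)))) ∘
      (extChartAt ((𝓡 p).prod (𝓡 q)) θ).symm) u a
      = fderiv ℝ ((fun y : Sph p => (y : EuclideanSpace ℝ (Fin (p + 1)))) ∘
        (extChartAt (𝓡 p) θ.1).symm) u.1 a.1 := by
    intro a
    have h : (fun θ : Sph p × Sph q => (θ.1 : EuclideanSpace ℝ (Fin (p + 1)))) ∘
        (extChartAt ((𝓡 p).prod (𝓡 q)) θ).symm
        = ((fun y : Sph p => (y : EuclideanSpace ℝ (Fin (p + 1)))) ∘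
          (extChartAt (𝓡 p) θ.1).symm) ∘ Prod.fst :=
      funext fun v => by simp only [Function.comp_apply, extChartAt_symm_prod]
    rw [h, fderiv_comp u (hd θ.1 u.1) differentiableAt_fst, fderiv_fst]
    rfl
  rw [h1, bilinComp_pullbackInner _ (extChartAt_target_prod θ)
      (Φ := fun θ : Sph p × Sph q => (θ.2 : EuclideanSpace ℝ (Fin (q + 1))))
      (mdifferentiable_coe_sph.comp mdifferentiable_snd),
    bilinComp_pullbackInner _ (extChartAt_target_prod θ)
      (Φ := fun θ : Sph p × Sph q => (θ.1 : EuclideanSpace ℝ (Fin (p + 1))))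
      (mdifferentiable_coe_sph.comp mdifferentiable_fst)]
  have k2 := inner_fderiv_extChartAt_symm θ.2 u.2 (prodBasis p q i).2 (prodBasis p q j).2
  have k1 := inner_fderiv_extChartAt_symm θ.1 u.1 (prodBasis p q i).1 (prodBasis p q j).1
  rw [← e2, ← e2] at k2
  rw [← e1, ← e1] at k1
  rw [← k1, ← k2]

theorem blockSq_prodBasis_inl (i : Fin p)
    (u : EuclideanSpace ℝ (Fin p) × EuclideanSpace ℝ (Fin q)) :
    blockSq (prodBasis p q) Sum.isLeft (Sum.inl i) u = ‖u.1‖ ^ 2 := by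
  simp [blockSq, prodBasis, sphBasis, EuclideanSpace.norm_sq_eq]

theorem blockSq_prodBasis_inr (i : Fin q)
    (u : EuclideanSpace ℝ (Fin p) × EuclideanSpace ℝ (Fin q)) :
    blockSq (prodBasis p q) Sum.isLeft (Sum.inr i) u = ‖u.2‖ ^ 2 := by
  simp [blockSq, prodBasis, sphBasis, EuclideanSpace.norm_sq_eq]

theorem isStereographicAt_prodMetric (θ : Sph p × Sph q) :
    IsStereographicAt ((𝓡 p).prod (𝓡 q)) (prodBasis p q) (prodMetric p q) θ Sum.isLeft
      (signs p q) where
  target_eq := extChartAt_target_prod θ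
  self_eq := extChartAt_self_prod θ
  sign_mul_self i := by cases i <;> simp [signs]
  sign_eq i j h := by
    cases i <;> cases j <;> simp [signs] at h ⊢
  comp_eq i j u := by
    rw [bilinComp_prodMetric]
    rcases i with i | i <;> rcases j with j | j
    · simp only [prodBasis_inl, inner_sphBasis, blockSq_prodBasis_inl]
      by_cases hij : i = j <;> simp [signs, hij]
    · simp [prodBasis_inl, prodBasis_inr]
    · simp [prodBasis_inl, prodBasis_inr]
    · simp [signs, prodBasis_inr, blockSq_prodBasis_inr, inner_sphBasis]

theorem dim_prodBasis : dim (prodBasis p q) = (p : ℝ) + q := by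
  simp [dim]

theorem sum_isLeft_eq (j : Fin p ⊕ Fin q) :
    (∑ i : Fin p ⊕ Fin q, if i.isLeft = j.isLeft then (1 : ℝ) else 0)
      = Sum.elim (fun _ => (p : ℝ)) (fun _ => (q : ℝ)) j := by
  rw [Fintype.sum_sum_type]
  cases j <;> simp [-Finset.sum_boole]

theorem scal_prodMetric (θ : Sph p × Sph q) :
    scal ((𝓡 p).prod (𝓡 q)) (prodBasis p q) (prodMetric p q) θ
      = ((p : ℝ) + q - 1) * ((q : ℝ) - p) := by
  rw [(isStereographicAt_prodMetric θ).scal_eq]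
  simp only [sum_isLeft_eq]
  simp [signs]
  ring

theorem schoutenJ_prodMetric (h2 : 2 ≤ p + q) (θ : Sph p × Sph q) :
    schoutenJ ((𝓡 p).prod (𝓡 q)) (prodBasis p q) (prodMetric p q) θ = ((q : ℝ) - p) / 2 := by
  have h : (2 : ℝ) ≤ p + q := by exact_mod_cast h2
  have h' : (p : ℝ) + q - 1 ≠ 0 := by linarith
  rw [schoutenJ, scal_prodMetric, dim_prodBasis]
  field_simp

/-- The Schouten tensor is half of the Riemannian product metric. -/
theorem schoutenV_basis (h3 : 3 ≤ p + q) (θ : Sph p × Sph q) (i j : Fin p ⊕ Fin q) :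
    schoutenV ((𝓡 p).prod (𝓡 q)) (prodBasis p q) (prodMetric p q) θ
        (prodBasis p q i : EuclideanSpace ℝ (Fin p) × EuclideanSpace ℝ (Fin q))
        (prodBasis p q j : EuclideanSpace ℝ (Fin p) × EuclideanSpace ℝ (Fin q))
      = if i = j then 1 / 2 else 0 := by
  have h : (3 : ℝ) ≤ p + q := by exact_mod_cast h3
  have h' : (p : ℝ) + q - 2 ≠ 0 := by linarith
  have hS := isStereographicAt_prodMetric θ
  have hV : schoutenV ((𝓡 p).prod (𝓡 q)) (prodBasis p q) (prodMetric p q) θ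
        (prodBasis p q i : EuclideanSpace ℝ (Fin p) × EuclideanSpace ℝ (Fin q))
        (prodBasis p q j : EuclideanSpace ℝ (Fin p) × EuclideanSpace ℝ (Fin q))
      = (dim (prodBasis p q) - 2)⁻¹ * (ricci ((𝓡 p).prod (𝓡 q)) (prodBasis p q) (prodMetric p q) θ
          (prodBasis p q i : EuclideanSpace ℝ (Fin p) × EuclideanSpace ℝ (Fin q))
          (prodBasis p q j : EuclideanSpace ℝ (Fin p) × EuclideanSpace ℝ (Fin q))
        - schoutenJ ((𝓡 p).prod (𝓡 q)) (prodBasis p q) (prodMetric p q) θ * prodMetric p q θ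
          (prodBasis p q i : EuclideanSpace ℝ (Fin p) × EuclideanSpace ℝ (Fin q))
          (prodBasis p q j : EuclideanSpace ℝ (Fin p) × EuclideanSpace ℝ (Fin q))) := rfl
  rw [hV, hS.ricci_basis, ← bilinComp_self (prodBasis p q) hS.target_eq, hS.comp_self,
    schoutenJ_prodMetric (by omega), dim_prodBasis]
  by_cases hij : i = j
  · subst hij
    rw [if_pos rfl, if_pos rfl, if_pos rfl, sum_isLeft_eq]
    rcases i with i | i
    · simp [signs]
      field_simp
      ring
    · simp [signs]
      field_simp
      ring
  · simp [hij]

theorem normSq_schoutenV (h3 : 3 ≤ p + q) (θ : Sph p × Sph q) :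
    normSq ((𝓡 p).prod (𝓡 q)) (prodBasis p q) (prodMetric p q)
      (schoutenV ((𝓡 p).prod (𝓡 q)) (prodBasis p q) (prodMetric p q)) θ = ((p : ℝ) + q) / 4 := by
  have hS := isStereographicAt_prodMetric θ
  rw [hS.normSq_eq]
  have : ∀ i j, signs p q i * signs p q j * bilinComp ((𝓡 p).prod (𝓡 q)) (prodBasis p q)
      (schoutenV ((𝓡 p).prod (𝓡 q)) (prodBasis p q) (prodMetric p q)) θ i j
        (extChartAt ((𝓡 p).prod (𝓡 q)) θ θ) ^ 2 = if i = j then 1 / 4 else 0 := by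
    intro i j
    rw [bilinComp_self _ hS.target_eq, schoutenV_basis h3]
    split_ifs with hij
    · subst hij
      rw [hS.sign_mul_self]
      norm_num
    · simp
  simp only [this]
  simp
  ring

/-- The coordinate vector fields of a product chart are tangent to the factors. -/
theorem repr_coordVec_eq_zero (θ : Sph p × Sph q) {i k : Fin p ⊕ Fin q}
    (hik : Sum.isLeft i ≠ Sum.isLeft k)
    (u : EuclideanSpace ℝ (Fin p) × EuclideanSpace ℝ (Fin q)) :
    (prodBasis p q).repr (coordVec ((𝓡 p).prod (𝓡 q)) (prodBasis p q) θ i u :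
      EuclideanSpace ℝ (Fin p) × EuclideanSpace ℝ (Fin q)) k = 0 := by
  have hψ := mdifferentiableAt_extChartAt_symm (extChartAt_target_prod θ) u
  rcases i with i | i <;> rcases k with k | k <;> simp at hik
  · have h1 := mfderiv_comp_apply u (mdifferentiableAt_snd (I := 𝓡 p) (I' := 𝓡 q)) hψ
      (prodBasis p q (Sum.inl i))
    have h2 : Prod.snd ∘ (extChartAt ((𝓡 p).prod (𝓡 q)) θ).symm
        = (extChartAt (𝓡 q) θ.2).symm ∘ Prod.snd :=
      funext fun v => by simp only [Function.comp_apply, extChartAt_symm_prod]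
    have h3 := mfderiv_comp_apply u (mdifferentiableAt_extChartAt_symm (extChartAt_target_sph θ.2)
      u.2) (differentiableAt_snd (𝕜 := ℝ)).mdifferentiableAt (prodBasis p q (Sum.inl i))
    rw [h2, h3, mfderiv_eq_fderiv, fderiv_snd, mfderiv_snd] at h1
    have h4 : (coordVec ((𝓡 p).prod (𝓡 q)) (prodBasis p q) θ (Sum.inl i) u :
        EuclideanSpace ℝ (Fin p) × EuclideanSpace ℝ (Fin q)).2 = 0 := by
      have h5 : ContinuousLinearMap.snd ℝ (EuclideanSpace ℝ (Fin p)) (EuclideanSpace ℝ (Fin q))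
          (prodBasis p q (Sum.inl i)) = 0 := by
        rw [prodBasis_inl]
        rfl
      exact h1.symm.trans ((congrArg _ h5).trans (map_zero _))
    exact (Module.Basis.prod_repr_inr _ _ _ k).trans (by rw [h4]; simp)
  · have h1 := mfderiv_comp_apply u (mdifferentiableAt_fst (I := 𝓡 p) (I' := 𝓡 q)) hψ
      (prodBasis p q (Sum.inr i))
    have h2 : Prod.fst ∘ (extChartAt ((𝓡 p).prod (𝓡 q)) θ).symm
        = (extChartAt (𝓡 p) θ.1).symm ∘ Prod.fst :=
      funext fun v => by simp only [Function.comp_apply, extChartAt_symm_prod]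
    have h3 := mfderiv_comp_apply u (mdifferentiableAt_extChartAt_symm (extChartAt_target_sph θ.1)
      u.1) (differentiableAt_fst (𝕜 := ℝ)).mdifferentiableAt (prodBasis p q (Sum.inr i))
    rw [h2, h3, mfderiv_eq_fderiv, fderiv_fst, mfderiv_fst] at h1
    have h4 : (coordVec ((𝓡 p).prod (𝓡 q)) (prodBasis p q) θ (Sum.inr i) u :
        EuclideanSpace ℝ (Fin p) × EuclideanSpace ℝ (Fin q)).1 = 0 := by
      have h5 : ContinuousLinearMap.fst ℝ (EuclideanSpace ℝ (Fin p)) (EuclideanSpace ℝ (Fin q))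
          (prodBasis p q (Sum.inr i)) = 0 := by
        rw [prodBasis_inr]
        rfl
      exact h1.symm.trans ((congrArg _ h5).trans (map_zero _))
    exact (Module.Basis.prod_repr_inl _ _ _ k).trans (by rw [h4]; simp)

/-! ### Second-order operators on the product -/

/-- In the components of a product chart, `T = (n - 2) J - 4 V` multiplies a 1-form by
`(n - 2) J - 2 ε`, with the sign `ε` of the respective factor. -/
theorem formComp_paneitzT (h3 : 3 ≤ p + q) (α : FormField ((𝓡 p).prod (𝓡 q)) (Sph p × Sph q))
    (θ : Sph p × Sph q) (i : Fin p ⊕ Fin q)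
    (u : EuclideanSpace ℝ (Fin p) × EuclideanSpace ℝ (Fin q)) :
    formComp ((𝓡 p).prod (𝓡 q)) (prodBasis p q)
        (paneitzT ((𝓡 p).prod (𝓡 q)) (prodBasis p q) (prodMetric p q) α) θ i u
      = (((p : ℝ) + q - 2) * (((q : ℝ) - p) / 2) - 2 * signs p q i)
        * formComp ((𝓡 p).prod (𝓡 q)) (prodBasis p q) α θ i u := by
  set y := (extChartAt ((𝓡 p).prod (𝓡 q)) θ).symm u with hy
  have hS := isStereographicAt_prodMetric y
  have hact : ∀ v : EuclideanSpace ℝ (Fin p) × EuclideanSpace ℝ (Fin q),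
      act ((𝓡 p).prod (𝓡 q)) (prodBasis p q) (prodMetric p q)
        (schoutenV ((𝓡 p).prod (𝓡 q)) (prodBasis p q) (prodMetric p q)) α y
          (v : EuclideanSpace ℝ (Fin p) × EuclideanSpace ℝ (Fin q))
        = ∑ k, (prodBasis p q).repr v k * (1 / 2 * signs p q k *
          α y (prodBasis p q k : EuclideanSpace ℝ (Fin p) × EuclideanSpace ℝ (Fin q))) := by
    intro v
    refine (formOfComp_apply (prodBasis p q) hS.target_eq _ _).trans ?_
    refine Finset.sum_congr rfl fun k _ => congrArg _ ?_
    simp only [bilinComp_self (prodBasis p q) hS.target_eq, schoutenV_basis h3, hS.invMetric_self,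
      formComp_self (prodBasis p q) hS.target_eq]
    simp
  have hα : ∀ v : EuclideanSpace ℝ (Fin p) × EuclideanSpace ℝ (Fin q),
      α y (v : EuclideanSpace ℝ (Fin p) × EuclideanSpace ℝ (Fin q))
        = ∑ k, (prodBasis p q).repr v k *
          α y (prodBasis p q k : EuclideanSpace ℝ (Fin p) × EuclideanSpace ℝ (Fin q)) := by
    intro v
    have h := map_sum (α y) (fun k => ((prodBasis p q).repr v k • prodBasis p q k :
      EuclideanSpace ℝ (Fin p) × EuclideanSpace ℝ (Fin q))) Finset.univ
    refine (congrArg (α y) ((prodBasis p q).sum_repr v).symm).trans (h.trans ?_)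
    exact Finset.sum_congr rfl fun k _ => map_smul (α y) _ _
  set v : EuclideanSpace ℝ (Fin p) × EuclideanSpace ℝ (Fin q) :=
    coordVec ((𝓡 p).prod (𝓡 q)) (prodBasis p q) θ i u with hv
  -- Only the coordinates of the factor of `i` contribute, and these all have the sign of `i`.
  have hact' : act ((𝓡 p).prod (𝓡 q)) (prodBasis p q) (prodMetric p q)
        (schoutenV ((𝓡 p).prod (𝓡 q)) (prodBasis p q) (prodMetric p q)) α y
          (v : EuclideanSpace ℝ (Fin p) × EuclideanSpace ℝ (Fin q))
      = 1 / 2 * signs p q i * α y (v : EuclideanSpace ℝ (Fin p) × EuclideanSpace ℝ (Fin q)) := by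
    rw [hact, hα, Finset.mul_sum]
    refine Finset.sum_congr rfl fun k _ => ?_
    by_cases hik : i.isLeft = k.isLeft
    · rw [hS.sign_eq i k hik]
      ring
    · have h0 : (prodBasis p q).repr v k = 0 := repr_coordVec_eq_zero θ hik u
      rw [h0]
      ring
  have hT : formComp ((𝓡 p).prod (𝓡 q)) (prodBasis p q)
        (paneitzT ((𝓡 p).prod (𝓡 q)) (prodBasis p q) (prodMetric p q) α) θ i u
      = ((dim (prodBasis p q) - 2)
          * schoutenJ ((𝓡 p).prod (𝓡 q)) (prodBasis p q) (prodMetric p q) y)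
          * α y (v : EuclideanSpace ℝ (Fin p) × EuclideanSpace ℝ (Fin q))
        - 4 * act ((𝓡 p).prod (𝓡 q)) (prodBasis p q) (prodMetric p q)
          (schoutenV ((𝓡 p).prod (𝓡 q)) (prodBasis p q) (prodMetric p q)) α y
            (v : EuclideanSpace ℝ (Fin p) × EuclideanSpace ℝ (Fin q)) := rfl
  have hf : formComp ((𝓡 p).prod (𝓡 q)) (prodBasis p q) α θ i u
    = α y (v : EuclideanSpace ℝ (Fin p) × EuclideanSpace ℝ (Fin q)) := rfl
  rw [hT, hf, hact', schoutenJ_prodMetric (by omega), dim_prodBasis]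
  ring

/-- The second derivatives of `f` at the centre of the product chart around `θ`. -/
def chartHess (f : Sph p × Sph q → ℝ) (θ : Sph p × Sph q) (i : Fin p ⊕ Fin q) : ℝ :=
  pd (prodBasis p q) i (pd (prodBasis p q) i
    (f ∘ (extChartAt ((𝓡 p).prod (𝓡 q)) θ).symm)) 0

theorem laplacian_prodMetric_eq_sum {f : Sph p × Sph q → ℝ}
    (hf : ContMDiff ((𝓡 p).prod (𝓡 q)) 𝓘(ℝ, ℝ) ∞ f) (θ : Sph p × Sph q) :
    laplacian ((𝓡 p).prod (𝓡 q)) (prodBasis p q) (prodMetric p q) f θ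
      = -∑ i, signs p q i * chartHess f θ i :=
  (isStereographicAt_prodMetric θ).laplacian_eq (hf.mdifferentiable (by simp))

theorem lapP_eq_sum {f : Sph p × Sph q → ℝ}
    (hf : ContMDiff ((𝓡 p).prod (𝓡 q)) 𝓘(ℝ, ℝ) ∞ f) (θ : Sph p × Sph q) :
    lapP f θ = -∑ i, chartHess f θ (Sum.inl i) := by
  have hφ := contDiff_comp_extChartAt_symm (extChartAt_target_prod θ) hf
  have hs : MDifferentiable (𝓡 p) 𝓘(ℝ, ℝ) fun y => f (y, θ.2) :=
    (hf.mdifferentiable (by simp)).comp (mdifferentiable_id.prodMk mdifferentiable_const)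
  rw [lapP, (isStereographicAt_roundMetric θ.1).laplacian_eq hs]
  refine congrArg _ (Finset.sum_congr rfl fun i _ => ?_)
  rw [one_mul]
  set φ := f ∘ (extChartAt ((𝓡 p).prod (𝓡 q)) θ).symm with hφ'
  have h1 : (fun y => f (y, θ.2)) ∘ (extChartAt (𝓡 p) θ.1).symm = fun v => φ (v, 0) := by
    funext v
    simp only [hφ', Function.comp_apply, extChartAt_symm_prod, extChartAt_symm_zero_sph]
  have h2 : ∀ {χ : EuclideanSpace ℝ (Fin p) × EuclideanSpace ℝ (Fin q) → ℝ},
      Differentiable ℝ χ → ∀ v, pd (sphBasis p) i (fun v => χ (v, 0)) v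
        = pd (prodBasis p q) (Sum.inl i) χ (v, 0) := by
    intro χ hχ v
    have := (HasFDerivAt.comp (f := fun v => (v, (0 : EuclideanSpace ℝ (Fin q)))) v
      (hχ (v, 0)).hasFDerivAt (hasFDerivAt_prodMk_left v 0)).fderiv
    rw [pd, pd, prodBasis_inl]
    exact congrArg (fun L => L (sphBasis p i)) this
  have h3 : Differentiable ℝ (pd (prodBasis p q) (Sum.inl i) φ) :=
    ((hφ.fderiv_right (m := ∞) le_rfl).clm_apply contDiff_const).differentiable (by simp)
  rw [h1, funext (h2 (hφ.differentiable (by simp))), h2 h3]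
  rfl

theorem lapQ_eq_sum {f : Sph p × Sph q → ℝ}
    (hf : ContMDiff ((𝓡 p).prod (𝓡 q)) 𝓘(ℝ, ℝ) ∞ f) (θ : Sph p × Sph q) :
    lapQ f θ = -∑ i, chartHess f θ (Sum.inr i) := by
  have hφ := contDiff_comp_extChartAt_symm (extChartAt_target_prod θ) hf
  have hs : MDifferentiable (𝓡 q) 𝓘(ℝ, ℝ) fun z => f (θ.1, z) :=
    (hf.mdifferentiable (by simp)).comp (mdifferentiable_const.prodMk mdifferentiable_id)
  rw [lapQ, (isStereographicAt_roundMetric θ.2).laplacian_eq hs]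
  refine congrArg _ (Finset.sum_congr rfl fun i _ => ?_)
  rw [one_mul]
  set φ := f ∘ (extChartAt ((𝓡 p).prod (𝓡 q)) θ).symm with hφ'
  have h1 : (fun z => f (θ.1, z)) ∘ (extChartAt (𝓡 q) θ.2).symm = fun v => φ (0, v) := by
    funext v
    simp only [hφ', Function.comp_apply, extChartAt_symm_prod, extChartAt_symm_zero_sph]
  have h2 : ∀ {χ : EuclideanSpace ℝ (Fin p) × EuclideanSpace ℝ (Fin q) → ℝ},
      Differentiable ℝ χ → ∀ v, pd (sphBasis q) i (fun v => χ (0, v)) v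
        = pd (prodBasis p q) (Sum.inr i) χ (0, v) := by
    intro χ hχ v
    have := (HasFDerivAt.comp (f := fun v => ((0 : EuclideanSpace ℝ (Fin p)), v)) v
      (hχ (0, v)).hasFDerivAt (hasFDerivAt_prodMk_right 0 v)).fderiv
    rw [pd, pd, prodBasis_inr]
    exact congrArg (fun L => L (sphBasis q i)) this
  have h3 : Differentiable ℝ (pd (prodBasis p q) (Sum.inr i) φ) :=
    ((hφ.fderiv_right (m := ∞) le_rfl).clm_apply contDiff_const).differentiable (by simp)
  rw [h1, funext (h2 (hφ.differentiable (by simp))), h2 h3]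
  rfl

theorem laplacian_prodMetric {f : Sph p × Sph q → ℝ}
    (hf : ContMDiff ((𝓡 p).prod (𝓡 q)) 𝓘(ℝ, ℝ) ∞ f) (θ : Sph p × Sph q) :
    laplacian ((𝓡 p).prod (𝓡 q)) (prodBasis p q) (prodMetric p q) f θ
      = lapQ f θ - lapP f θ := by
  rw [laplacian_prodMetric_eq_sum hf, lapP_eq_sum hf, lapQ_eq_sum hf, Fintype.sum_sum_type]
  simp [signs]

theorem codiff_paneitzT_diff (h3 : 3 ≤ p + q) {f : Sph p × Sph q → ℝ}
    (hf : ContMDiff ((𝓡 p).prod (𝓡 q)) 𝓘(ℝ, ℝ) ∞ f) (θ : Sph p × Sph q) :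
    codiff ((𝓡 p).prod (𝓡 q)) (prodBasis p q) (prodMetric p q)
        (paneitzT ((𝓡 p).prod (𝓡 q)) (prodBasis p q) (prodMetric p q)
          (diff ((𝓡 p).prod (𝓡 q)) f)) θ
      = ((p : ℝ) + q - 2) * (((q : ℝ) - p) / 2) * (lapQ f θ - lapP f θ)
        - 2 * (lapQ f θ + lapP f θ) := by
  have hS := isStereographicAt_prodMetric θ
  have hc : ∀ i, pd (prodBasis p q) i (formComp ((𝓡 p).prod (𝓡 q)) (prodBasis p q)
      (paneitzT ((𝓡 p).prod (𝓡 q)) (prodBasis p q) (prodMetric p q)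
        (diff ((𝓡 p).prod (𝓡 q)) f)) θ i) 0
      = (((p : ℝ) + q - 2) * (((q : ℝ) - p) / 2) - 2 * signs p q i) * chartHess f θ i := by
    intro i
    have : formComp ((𝓡 p).prod (𝓡 q)) (prodBasis p q)
        (paneitzT ((𝓡 p).prod (𝓡 q)) (prodBasis p q) (prodMetric p q)
          (diff ((𝓡 p).prod (𝓡 q)) f)) θ i
        = fun u => (((p : ℝ) + q - 2) * (((q : ℝ) - p) / 2) - 2 * signs p q i)
          * pd (prodBasis p q) i (f ∘ (extChartAt ((𝓡 p).prod (𝓡 q)) θ).symm) u :=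
      funext fun u => by
        rw [formComp_paneitzT h3, formComp_diff _ hS.target_eq (hf.mdifferentiable (by simp))]
    have hd : DifferentiableAt ℝ
        (pd (prodBasis p q) i (f ∘ (extChartAt ((𝓡 p).prod (𝓡 q)) θ).symm)) 0 :=
      (((contDiff_comp_extChartAt_symm hS.target_eq hf).fderiv_right (m := ∞) le_rfl).clm_apply
        contDiff_const).differentiable (by simp) 0
    rw [this, pd, fderiv_const_mul hd]
    rfl
  rw [hS.codiff_eq, lapP_eq_sum hf, lapQ_eq_sum hf]
  simp only [hc]
  rw [Fintype.sum_sum_type]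
  simp only [signs, Sum.elim_inl, Sum.elim_inr, ← mul_assoc, ← Finset.mul_sum]
  ring

theorem laplacian_const {c : ℝ} {f : Sph p × Sph q → ℝ} (hf : ∀ θ, f θ = c) (θ : Sph p × Sph q) :
    laplacian ((𝓡 p).prod (𝓡 q)) (prodBasis p q) (prodMetric p q) f θ = 0 := by
  obtain rfl : f = fun _ => c := funext hf
  have hc : ∀ i, chartHess (fun _ : Sph p × Sph q => c) θ i = 0 := by
    intro i
    have h1 : (fun _ : Sph p × Sph q => c) ∘ (extChartAt ((𝓡 p).prod (𝓡 q)) θ).symm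
      = fun _ => c := rfl
    have h2 : pd (prodBasis p q) i (fun _ => c) = fun _ => 0 := funext fun u => by simp [pd]
    rw [chartHess, h1, h2]
    simp [pd]
  rw [laplacian_prodMetric_eq_sum contMDiff_const]
  simp [hc]

theorem paneitzQ_prodMetric (h3 : 3 ≤ p + q) (θ : Sph p × Sph q) :
    paneitzQ ((𝓡 p).prod (𝓡 q)) (prodBasis p q) (prodMetric p q) θ
      = ((p : ℝ) + q) / 2 * (((q : ℝ) - p) / 2) ^ 2 - ((p : ℝ) + q) / 2 := by
  rw [paneitzQ, laplacian_const (schoutenJ_prodMetric (by omega)), normSq_schoutenV h3,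
    schoutenJ_prodMetric (by omega), dim_prodBasis]
  ring

/-! ### Derivations of smooth functions on an open set -/

section LieDeriv

variable {E : Type*} [NormedAddCommGroup E] [NormedSpace ℝ E]

/-- The space of smooth functions on the open set `Ω`, extended by zero to the whole space, so
that differential operators act on it as linear endomorphisms. -/
def smoothFun (Ω : TopologicalSpace.Opens E) : Submodule ℝ (E → ℝ) where
  carrier := {F | ContDiffOn ℝ ∞ F Ω ∧ ∀ x ∉ Ω, F x = 0}
  add_mem' hF hG := ⟨hF.1.add hG.1, fun x hx => by simp [hF.2 x hx, hG.2 x hx]⟩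
  zero_mem' := ⟨contDiffOn_const, fun _ _ => rfl⟩
  smul_mem' c _ hF := ⟨contDiffOn_const.smul hF.1, fun x hx => by simp [hF.2 x hx]⟩

variable {Ω : TopologicalSpace.Opens E}

theorem contDiffAt_smoothFun (F : smoothFun Ω) {x : E} (hx : x ∈ Ω) :
    ContDiffAt ℝ ∞ (F : E → ℝ) x :=
  F.2.1.contDiffAt (Ω.isOpen.mem_nhds hx)

theorem differentiableAt_smoothFun (F : smoothFun Ω) {x : E} (hx : x ∈ Ω) :
    DifferentiableAt ℝ (F : E → ℝ) x :=
  (contDiffAt_smoothFun F hx).differentiableAt (by simp)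

theorem smoothFun_ext {F G : smoothFun Ω}
    (h : ∀ x ∈ Ω, (F : E → ℝ) x = (G : E → ℝ) x) : F = G := by
  refine Subtype.ext (funext fun x => ?_)
  by_cases hx : x ∈ Ω
  · exact h x hx
  · rw [F.2.2 x hx, G.2.2 x hx]

open Classical in
/-- The restriction to `Ω` of a function that is smooth there. -/
def restrictSmooth (F : E → ℝ) (hF : ContDiffOn ℝ ∞ F Ω) : smoothFun Ω :=
  ⟨fun x => if x ∈ Ω then F x else 0, hF.congr fun _ hx => if_pos hx, fun _ hx => if_neg hx⟩

theorem restrictSmooth_apply {F : E → ℝ} (hF : ContDiffOn ℝ ∞ F Ω) {x : E} (hx : x ∈ Ω) :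
    (restrictSmooth F hF : E → ℝ) x = F x := if_pos hx

theorem contDiffOn_fderiv_apply {F : E → ℝ} (hF : ContDiffOn ℝ ∞ F Ω) {X : E → E}
    (hX : ContDiff ℝ ∞ X) : ContDiffOn ℝ ∞ (fun x => fderiv ℝ F x (X x)) Ω :=
  (hF.fderiv_of_isOpen Ω.isOpen (m := ∞) le_rfl).clm_apply hX.contDiffOn

/-- The derivation of the smooth functions on `Ω` given by the vector field `X`. -/
def lieDeriv (X : E → E) (hX : ContDiff ℝ ∞ X) : Module.End ℝ (smoothFun Ω) where
  toFun F := restrictSmooth _ (contDiffOn_fderiv_apply F.2.1 hX)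
  map_add' F G := smoothFun_ext fun x hx => by
    rw [restrictSmooth_apply _ hx, Submodule.coe_add, Submodule.coe_add, Pi.add_apply,
      restrictSmooth_apply _ hx, restrictSmooth_apply _ hx,
      fderiv_add (differentiableAt_smoothFun F hx) (differentiableAt_smoothFun G hx)]
    rfl
  map_smul' c F := smoothFun_ext fun x hx => by
    rw [RingHom.id_apply, restrictSmooth_apply _ hx, Submodule.coe_smul, Submodule.coe_smul,
      Pi.smul_apply, restrictSmooth_apply _ hx,
      fderiv_const_smul (differentiableAt_smoothFun F hx)]
    rfl

theorem lieDeriv_apply {X : E → E} (hX : ContDiff ℝ ∞ X) (F : smoothFun Ω) {x : E} (hx : x ∈ Ω) :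
    (lieDeriv X hX F : E → ℝ) x = fderiv ℝ (F : E → ℝ) x (X x) :=
  restrictSmooth_apply (contDiffOn_fderiv_apply F.2.1 hX) hx

theorem lieDeriv_lieDeriv_apply {X Y : E → E} (hX : ContDiff ℝ ∞ X) (hY : ContDiff ℝ ∞ Y)
    (F : smoothFun Ω) {x : E} (hx : x ∈ Ω) :
    (lieDeriv X hX (lieDeriv Y hY F) : E → ℝ) x
      = fderiv ℝ (fderiv ℝ (F : E → ℝ)) x (X x) (Y x)
        + fderiv ℝ (F : E → ℝ) x (fderiv ℝ Y x (X x)) := by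
  have he : (lieDeriv Y hY F : E → ℝ) =ᶠ[nhds x] fun x => fderiv ℝ (F : E → ℝ) x (Y x) :=
    Filter.mem_of_superset (Ω.isOpen.mem_nhds hx) fun y hy => lieDeriv_apply hY F hy
  have h1 : DifferentiableAt ℝ (fderiv ℝ (F : E → ℝ)) x :=
    ((contDiffAt_smoothFun F hx).fderiv_right (m := ∞) le_rfl).differentiableAt (by simp)
  have h2 : DifferentiableAt ℝ Y x := (hY.differentiable (by simp)) x
  rw [lieDeriv_apply hX _ hx, he.fderiv_eq, (h1.hasFDerivAt.clm_apply h2.hasFDerivAt).fderiv]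
  simp
  ring

/-- The commutator of two derivations is the derivation given by the Lie bracket. -/
theorem lieDeriv_comm {X Y Z : E → E} (hX : ContDiff ℝ ∞ X) (hY : ContDiff ℝ ∞ Y)
    (hZ : ContDiff ℝ ∞ Z) (h : ∀ x, fderiv ℝ Y x (X x) = fderiv ℝ X x (Y x) + Z x)
    (F : smoothFun Ω) :
    lieDeriv X hX (lieDeriv Y hY F) = lieDeriv Y hY (lieDeriv X hX F) + lieDeriv Z hZ F := by
  refine smoothFun_ext fun x hx => ?_
  have hs : IsSymmSndFDerivAt ℝ (F : E → ℝ) x :=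
    (contDiffAt_smoothFun F hx).isSymmSndFDerivAt <| by
      rw [minSmoothness_of_isRCLikeNormedField]
      exact WithTop.coe_le_coe.2 le_top
  rw [Submodule.coe_add, Pi.add_apply, lieDeriv_lieDeriv_apply hX hY F hx,
    lieDeriv_lieDeriv_apply hY hX F hx, lieDeriv_apply hZ F hx, h, map_add, hs (X x) (Y x)]
  ring

theorem lieDeriv_comm' {X Y : E → E} (hX : ContDiff ℝ ∞ X) (hY : ContDiff ℝ ∞ Y)
    (h : ∀ x, fderiv ℝ Y x (X x) = fderiv ℝ X x (Y x)) (F : smoothFun Ω) :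
    lieDeriv X hX (lieDeriv Y hY F) = lieDeriv Y hY (lieDeriv X hX F) := by
  rw [lieDeriv_comm hX hY (contDiff_const (c := 0)) (fun x => by simp [h x]) F]
  refine add_eq_left.2 (smoothFun_ext fun x hx => ?_)
  rw [lieDeriv_apply _ _ hx]
  simp

/-- The directional derivative along the vector `v`. -/
def dirDeriv (v : E) : Module.End ℝ (smoothFun Ω) := lieDeriv (fun _ => v) contDiff_const

/-- The derivation given by the linear vector field `L`. -/
def linDeriv (L : E →L[ℝ] E) : Module.End ℝ (smoothFun Ω) := lieDeriv L L.contDiff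

/-- The sum of the second derivatives along the vectors `e i`. -/
def sumSqDeriv {ι : Type*} [Fintype ι] (e : ι → E) : Module.End ℝ (smoothFun Ω) :=
  ∑ i, dirDeriv (e i) * dirDeriv (e i)

theorem dirDeriv_linDeriv (v : E) (L : E →L[ℝ] E) (F : smoothFun Ω) :
    dirDeriv v (linDeriv L F) = linDeriv L (dirDeriv v F) + dirDeriv (L v) F :=
  lieDeriv_comm _ _ _ (fun x => by simp) F

theorem linDeriv_comm {L M : E →L[ℝ] E} (h : ∀ x, L (M x) = M (L x)) (F : smoothFun Ω) :
    linDeriv L (linDeriv M F) = linDeriv M (linDeriv L F) :=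
  lieDeriv_comm' _ _ (fun x => by simp [h]) F

theorem dirDeriv_comm (v w : E) (F : smoothFun Ω) :
    dirDeriv v (dirDeriv w F) = dirDeriv w (dirDeriv v F) :=
  lieDeriv_comm' _ _ (fun x => by simp) F

theorem dirDeriv_zero (F : smoothFun Ω) : dirDeriv 0 F = 0 :=
  smoothFun_ext fun x hx => by
    rw [dirDeriv, lieDeriv_apply _ _ hx]
    simp

section SumSq

variable {ι κ : Type*} [Fintype ι] [Fintype κ]

theorem sumSqDeriv_eq (e : ι → E) (F : smoothFun Ω) :
    sumSqDeriv e F = ∑ i, dirDeriv (e i) (dirDeriv (e i) F) := by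
  simp [sumSqDeriv]

theorem linDeriv_sumSqDeriv_of_eq_self {e : ι → E} {L : E →L[ℝ] E} (h : ∀ i, L (e i) = e i)
    (F : smoothFun Ω) :
    linDeriv L (sumSqDeriv e F) = sumSqDeriv e (linDeriv L F) - (2 : ℝ) • sumSqDeriv e F := by
  simp only [sumSqDeriv_eq, map_sum, Finset.smul_sum, ← Finset.sum_sub_distrib]
  refine Finset.sum_congr rfl fun i _ => ?_
  simp only [dirDeriv_linDeriv, map_add, h]
  module

theorem linDeriv_sumSqDeriv_of_eq_zero {e : ι → E} {L : E →L[ℝ] E} (h : ∀ i, L (e i) = 0)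
    (F : smoothFun Ω) :
    linDeriv L (sumSqDeriv e F) = sumSqDeriv e (linDeriv L F) := by
  simp only [sumSqDeriv_eq, map_sum]
  refine Finset.sum_congr rfl fun i _ => ?_
  simp only [dirDeriv_linDeriv, h, dirDeriv_zero, add_zero]

theorem sumSqDeriv_comm (e : ι → E) (e' : κ → E) (F : smoothFun Ω) :
    sumSqDeriv e (sumSqDeriv e' F) = sumSqDeriv e' (sumSqDeriv e F) := by
  simp only [sumSqDeriv_eq, map_sum]
  rw [Finset.sum_comm]
  refine Finset.sum_congr rfl fun i _ => Finset.sum_congr rfl fun j _ => ?_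
  rw [dirDeriv_comm (e i) (e' j), dirDeriv_comm (e i) (e' j), dirDeriv_comm (e i) (e' j),
    dirDeriv_comm (e i) (e' j)]

end SumSq

end LieDeriv

/-! ### Operator identities for `□` and `□²` -/

section Identities

/-- The identity behind the restriction of `□`. The operators `Dp` and `Dq` are those that restrict
to the Laplacians of the spheres; for the weight `w = 1 - n / 2` no radial derivative of `F` is
left on the right-hand side. -/
theorem box_identity {V : Type*} [AddCommGroup V] [Module ℝ V] {Lp Lq R S Dp Dq : Module.End ℝ V}
    {p q w : ℝ} (hDp : ∀ x, Dp x = -Lp x + S (S x) + (p - 1) • S x)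
    (hDq : ∀ x, Dq x = -Lq x + R (R x) + (q - 1) • R x)
    (hRS : ∀ x, R (S x) = S (R x)) {F : V} (hF : R F = w • F - S F) (hw : w = 1 - (p + q) / 2) :
    Lp F - Lq F = Dq F - Dp F - ((q - p) / 2 * w) • F := by
  subst hw
  simp only [hDp, hDq, hRS, hF, map_sub, map_smul]
  module

/-- The identity behind the restriction of `□²`: by the commutation relations all radial derivatives
of `F` cancel for the weight `w = 2 - n / 2`. -/
theorem box_box_identity {V : Type*} [AddCommGroup V] [Module ℝ V]
    {Lp Lq R S Dp Dq : Module.End ℝ V}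
    {p q w κ : ℝ} (hDp : ∀ x, Dp x = -Lp x + S (S x) + (p - 1) • S x)
    (hDq : ∀ x, Dq x = -Lq x + R (R x) + (q - 1) • R x)
    (hRS : ∀ x, R (S x) = S (R x)) (hSLp : ∀ x, S (Lp x) = Lp (S x) - (2 : ℝ) • Lp x)
    (hRLq : ∀ x, R (Lq x) = Lq (R x) - (2 : ℝ) • Lq x)
    (hRLp : ∀ x, R (Lp x) = Lp (R x)) (hL : ∀ x, Lq (Lp x) = Lp (Lq x)) {F : V}
    (hF : R F = w • F - S F)
    (hw : w = 2 - (p + q) / 2) (hκ : κ = (p + q - 2) * (q - p) / 4) :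
    Lp (Lp F - Lq F) - Lq (Lp F - Lq F)
      = Dq (Dq F) + Dp (Dp F) - (2 : ℝ) • Dq (Dp F) - (2 * (1 - κ)) • Dq F
        + (2 * (-1 - κ)) • Dp F
        + (κ ^ 2 + (p + q) - (p + q) ^ 2 / 2 + p * q) • F := by
  subst hw hκ
  -- As rewrite rules, the relations move `R` and `S` past `Lp` and `Lq`, and `hF` then replaces `R`,
  -- so that both sides become combinations of words in `Lp`, `Lq`, `S` in a fixed order.
  simp only [hDp, hDq, hRS, hSLp, hRLq, hRLp, hL, hF, map_add, map_sub, map_neg, map_smul]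
  module

/-- The operators that restrict to the Laplacians of the two factors commute. -/
theorem sphOp_comm_of_relations {V : Type*} [AddCommGroup V] [Module ℝ V]
    {Lp Lq R S Dp Dq : Module.End ℝ V}
    {p q : ℝ} (hDp : ∀ x, Dp x = -Lp x + S (S x) + (p - 1) • S x)
    (hDq : ∀ x, Dq x = -Lq x + R (R x) + (q - 1) • R x)
    (hRS : ∀ x, R (S x) = S (R x))
    (hSLq : ∀ x, S (Lq x) = Lq (S x)) (hRLp : ∀ x, R (Lp x) = Lp (R x))
    (hL : ∀ x, Lq (Lp x) = Lp (Lq x)) (x : V) : Dp (Dq x) = Dq (Dp x) := by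
  simp only [hDp, hDq, hRS, hSLq, hRLp, hL, map_add, map_neg, map_smul]
  module

end Identities
open TopologicalSpace

/-! ### The ambient operators near the product of spheres -/

/-- The projection of the ambient space to its first factor. -/
def projP : Amb p q →L[ℝ] Amb p q :=
  (ContinuousLinearMap.inl ℝ _ _).comp (ContinuousLinearMap.fst ℝ _ _)

/-- The projection of the ambient space to its second factor. -/
def projQ : Amb p q →L[ℝ] Amb p q :=
  (ContinuousLinearMap.inr ℝ _ _).comp (ContinuousLinearMap.snd ℝ _ _)

/-- The standard unit vectors of the first factor of the ambient space. -/
def unitP (i : Fin (p + 1)) : Amb p q := (EuclideanSpace.basisFun _ ℝ i, 0)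

/-- The standard unit vectors of the second factor of the ambient space. -/
def unitQ (i : Fin (q + 1)) : Amb p q := (0, EuclideanSpace.basisFun _ ℝ i)

variable {Ω : Opens (Amb p q)}

/-- The operator that restricts to `Δ_{S^p}`, in terms of the flat Laplacian and the radial
vector field. -/
def sphOpP : Module.End ℝ (smoothFun Ω) :=
  -sumSqDeriv unitP + linDeriv projP * linDeriv projP + ((p : ℝ) - 1) • linDeriv projP

/-- The operator that restricts to `Δ_{S^q}`, in terms of the flat Laplacian and the radial
vector field. -/
def sphOpQ : Module.End ℝ (smoothFun Ω) :=
  -sumSqDeriv unitQ + linDeriv projQ * linDeriv projQ + ((q : ℝ) - 1) • linDeriv projQ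

theorem sphOpP_apply (F : smoothFun Ω) :
    sphOpP F = -sumSqDeriv unitP F + linDeriv projP (linDeriv projP F)
      + ((p : ℝ) - 1) • linDeriv projP F := rfl

theorem sphOpQ_apply (F : smoothFun Ω) :
    sphOpQ F = -sumSqDeriv unitQ F + linDeriv projQ (linDeriv projQ F)
      + ((q : ℝ) - 1) • linDeriv projQ F := rfl

theorem projQ_projP (x : Amb p q) : projQ (projP x) = projP (projQ x) := by
  simp [projP, projQ]

theorem sumSqDeriv_apply {ι : Type*} [Fintype ι] (e : ι → Amb p q) (F : smoothFun Ω) {x : Amb p q}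
    (hx : x ∈ Ω) : (sumSqDeriv e F : Amb p q → ℝ) x
      = ∑ i, fderiv ℝ (fderiv ℝ (F : Amb p q → ℝ)) x (e i) (e i) := by
  rw [sumSqDeriv_eq, Submodule.coe_sum, Finset.sum_apply]
  refine Finset.sum_congr rfl fun i _ => ?_
  rw [dirDeriv, lieDeriv_lieDeriv_apply _ _ _ hx]
  simp

theorem linDeriv_linDeriv_apply {L : Amb p q →L[ℝ] Amb p q} (hL : ∀ x, L (L x) = L x)
    (F : smoothFun Ω) {x : Amb p q} (hx : x ∈ Ω) :
    (linDeriv L (linDeriv L F) : Amb p q → ℝ) x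
      = fderiv ℝ (fderiv ℝ (F : Amb p q → ℝ)) x (L x) (L x)
        + fderiv ℝ (F : Amb p q → ℝ) x (L x) := by
  rw [linDeriv, lieDeriv_lieDeriv_apply _ _ _ hx]
  simp [hL]

/-- The first two derivatives of `F ∘ A`, for a map `A` with constant derivative `L`. -/
theorem fderiv_fderiv_comp_affine {E E' : Type*} [NormedAddCommGroup E] [NormedSpace ℝ E]
    [NormedAddCommGroup E'] [NormedSpace ℝ E'] {F : E → ℝ} {A : E' → E} {L : E' →L[ℝ] E}
    (hA : ∀ y, HasFDerivAt A L y) {y : E'} (hF : ContDiffAt ℝ ∞ F (A y)) (a c : E') :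
    fderiv ℝ (fun y => F (A y)) y a = fderiv ℝ F (A y) (L a) ∧
    fderiv ℝ (fderiv ℝ (fun y => F (A y))) y a c = fderiv ℝ (fderiv ℝ F) (A y) (L a) (L c) := by
  have h1 : ∀ y, DifferentiableAt ℝ F (A y) →
      fderiv ℝ (fun y => F (A y)) y = (fderiv ℝ F (A y)).comp L :=
    fun y hy => (hy.hasFDerivAt.comp y (hA y)).fderiv
  refine ⟨by rw [h1 y (hF.differentiableAt (by simp))]; rfl, ?_⟩
  have hev : fderiv ℝ (fun y => F (A y)) =ᶠ[nhds y] fun y => (fderiv ℝ F (A y)).comp L := by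
    have h2 : ∀ᶠ x in nhds (A y), ContDiffAt ℝ 1 F x :=
      (hF.of_le (by simp : (1 : ℕ∞ω) ≤ ∞)).eventually (by simp)
    exact ((hA y).continuousAt.eventually h2).mono fun z hz =>
      h1 z (hz.differentiableAt one_ne_zero)
  have h3 : DifferentiableAt ℝ (fderiv ℝ F) (A y) :=
    (hF.fderiv_right (m := ∞) le_rfl).differentiableAt (by simp)
  have h4 := (h3.hasFDerivAt.comp y (hA y)).clm_comp (hasFDerivAt_const L y)
  rw [hev.fderiv_eq]
  refine (congrArg (fun T => T a c) h4.fderiv).trans ?_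
  simp

section Slices

theorem hasFDerivAt_sliceP (z : EuclideanSpace ℝ (Fin (q + 1)))
    (y : EuclideanSpace ℝ (Fin (p + 1))) :
    HasFDerivAt (fun y => ((y, z) : Amb p q)) (ContinuousLinearMap.inl ℝ _ _) y :=
  hasFDerivAt_prodMk_left y z

theorem hasFDerivAt_sliceQ (y : EuclideanSpace ℝ (Fin (p + 1)))
    (z : EuclideanSpace ℝ (Fin (q + 1))) :
    HasFDerivAt (fun z => ((y, z) : Amb p q)) (ContinuousLinearMap.inr ℝ _ _) z :=
  hasFDerivAt_prodMk_right y z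

/-- The Laplacian in the first variable is the sum of second derivatives along `unitP`. -/
theorem laplacian_sliceP (F : smoothFun Ω) {y : EuclideanSpace ℝ (Fin (p + 1))}
    {z : EuclideanSpace ℝ (Fin (q + 1))} (hx : (y, z) ∈ Ω) :
    (Laplacian.laplacian (fun y => (F : Amb p q → ℝ) (y, z)) :
      EuclideanSpace ℝ (Fin (p + 1)) → ℝ) y = (sumSqDeriv unitP F : Amb p q → ℝ) (y, z) := by
  rw [InnerProductSpace.laplacian_eq_iteratedFDeriv_orthonormalBasis _
    (EuclideanSpace.basisFun _ ℝ), sumSqDeriv_apply _ _ hx]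
  refine Finset.sum_congr rfl fun i _ => ?_
  rw [iteratedFDeriv_two_apply]
  exact (fderiv_fderiv_comp_affine (hasFDerivAt_sliceP z) (y := y)
    (contDiffAt_smoothFun F hx) _ _).2

/-- The Laplacian in the second variable is the sum of second derivatives along `unitQ`. -/
theorem laplacian_sliceQ (F : smoothFun Ω) {y : EuclideanSpace ℝ (Fin (p + 1))}
    {z : EuclideanSpace ℝ (Fin (q + 1))} (hx : (y, z) ∈ Ω) :
    (Laplacian.laplacian (fun z => (F : Amb p q → ℝ) (y, z)) :
      EuclideanSpace ℝ (Fin (q + 1)) → ℝ) z = (sumSqDeriv unitQ F : Amb p q → ℝ) (y, z) := by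
  rw [InnerProductSpace.laplacian_eq_iteratedFDeriv_orthonormalBasis _
    (EuclideanSpace.basisFun _ ℝ), sumSqDeriv_apply _ _ hx]
  refine Finset.sum_congr rfl fun i _ => ?_
  rw [iteratedFDeriv_two_apply]
  exact (fderiv_fderiv_comp_affine (hasFDerivAt_sliceQ y) (y := z)
    (contDiffAt_smoothFun F hx) _ _).2

theorem box_smoothFun (F : smoothFun Ω) {x : Amb p q} (hx : x ∈ Ω) :
    box (F : Amb p q → ℝ) x
      = ((sumSqDeriv unitP F - sumSqDeriv unitQ F : smoothFun Ω) : Amb p q → ℝ) x := by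
  rw [box, laplacian_sliceP F hx, laplacian_sliceQ F hx, Submodule.coe_sub, Pi.sub_apply]
  ring

theorem lapP_smoothFun (hΩ : Set.range (incl (p := p) (q := q)) ⊆ Ω) (F : smoothFun Ω)
    (θ : Sph p × Sph q) :
    lapP ((F : Amb p q → ℝ) ∘ incl) θ = (sphOpP F : Amb p q → ℝ) (incl θ) := by
  have hθ : ∀ θ, incl θ ∈ Ω := fun θ => hΩ ⟨θ, rfl⟩
  have hF : ∀ y : Sph p, ContDiffAt ℝ ∞
      (fun y => (F : Amb p q → ℝ) (y, (θ.2 : EuclideanSpace ℝ (Fin (q + 1))))) y := fun y =>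
    ContDiffAt.comp (f := fun y => ((y, θ.2.1) : Amb p q)) y.1
      (contDiffAt_smoothFun F (hθ (y, θ.2))) (contDiffAt_id.prodMk contDiffAt_const)
  have h := laplacian_ambient_eq hF θ.1
  have h2 := fderiv_fderiv_comp_affine (hasFDerivAt_sliceP (θ.2 : EuclideanSpace ℝ (Fin (q + 1))))
    (y := (θ.1 : EuclideanSpace ℝ (Fin (p + 1)))) (contDiffAt_smoothFun F (hθ θ)) θ.1 θ.1
  have h3 : (Laplacian.laplacian (fun y => (F : Amb p q → ℝ) (y, θ.2.1)) :
      EuclideanSpace ℝ (Fin (p + 1)) → ℝ) θ.1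
      = (sumSqDeriv unitP F : Amb p q → ℝ) (incl θ) :=
    laplacian_sliceP (y := θ.1.1) (z := θ.2.1) F (hθ θ)
  have h4 := linDeriv_linDeriv_apply (L := projP) (fun _ => rfl) F (hθ θ)
  have h5 : (linDeriv projP F : Amb p q → ℝ) (incl θ)
      = fderiv ℝ (F : Amb p q → ℝ) (incl θ) (projP (incl θ)) := lieDeriv_apply _ F (hθ θ)
  have h6 : lapP ((F : Amb p q → ℝ) ∘ incl) θ
      = laplacian (𝓡 p) (sphBasis p) (roundMetric p)
        (fun y : Sph p => (F : Amb p q → ℝ) (y, θ.2.1)) θ.1 := rfl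
  have h7 : fderiv ℝ (fun y => (F : Amb p q → ℝ) (y, θ.2.1)) θ.1.1 θ.1.1
      = fderiv ℝ (F : Amb p q → ℝ) (incl θ) (projP (incl θ)) := h2.1
  have h8 : fderiv ℝ (fderiv ℝ fun y => (F : Amb p q → ℝ) (y, θ.2.1)) θ.1.1 θ.1.1 θ.1.1
      = fderiv ℝ (fderiv ℝ (F : Amb p q → ℝ)) (incl θ) (projP (incl θ)) (projP (incl θ)) := h2.2
  rw [h3, h7, h8, ← h6] at h
  rw [sphOpP_apply, Submodule.coe_add, Submodule.coe_add, Submodule.coe_neg, Submodule.coe_smul,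
    Pi.add_apply, Pi.add_apply, Pi.neg_apply, Pi.smul_apply, h4, h5, h, smul_eq_mul]
  ring

theorem lapQ_smoothFun (hΩ : Set.range (incl (p := p) (q := q)) ⊆ Ω) (F : smoothFun Ω)
    (θ : Sph p × Sph q) :
    lapQ ((F : Amb p q → ℝ) ∘ incl) θ = (sphOpQ F : Amb p q → ℝ) (incl θ) := by
  have hθ : ∀ θ, incl θ ∈ Ω := fun θ => hΩ ⟨θ, rfl⟩
  have hF : ∀ z : Sph q, ContDiffAt ℝ ∞
      (fun z => (F : Amb p q → ℝ) ((θ.1 : EuclideanSpace ℝ (Fin (p + 1))), z)) z := fun z =>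
    ContDiffAt.comp (f := fun z => ((θ.1.1, z) : Amb p q)) z.1
      (contDiffAt_smoothFun F (hθ (θ.1, z))) (contDiffAt_const.prodMk contDiffAt_id)
  have h := laplacian_ambient_eq hF θ.2
  have h2 := fderiv_fderiv_comp_affine (hasFDerivAt_sliceQ (θ.1 : EuclideanSpace ℝ (Fin (p + 1))))
    (y := (θ.2 : EuclideanSpace ℝ (Fin (q + 1)))) (contDiffAt_smoothFun F (hθ θ)) θ.2 θ.2
  have h3 : (Laplacian.laplacian (fun z => (F : Amb p q → ℝ) (θ.1.1, z)) :
      EuclideanSpace ℝ (Fin (q + 1)) → ℝ) θ.2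
      = (sumSqDeriv unitQ F : Amb p q → ℝ) (incl θ) :=
    laplacian_sliceQ (y := θ.1.1) (z := θ.2.1) F (hθ θ)
  have h4 := linDeriv_linDeriv_apply (L := projQ) (fun _ => rfl) F (hθ θ)
  have h5 : (linDeriv projQ F : Amb p q → ℝ) (incl θ)
      = fderiv ℝ (F : Amb p q → ℝ) (incl θ) (projQ (incl θ)) := lieDeriv_apply _ F (hθ θ)
  have h6 : lapQ ((F : Amb p q → ℝ) ∘ incl) θ
      = laplacian (𝓡 q) (sphBasis q) (roundMetric q)
        (fun z : Sph q => (F : Amb p q → ℝ) (θ.1.1, z)) θ.2 := rfl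
  have h7 : fderiv ℝ (fun z => (F : Amb p q → ℝ) (θ.1.1, z)) θ.2.1 θ.2.1
      = fderiv ℝ (F : Amb p q → ℝ) (incl θ) (projQ (incl θ)) := h2.1
  have h8 : fderiv ℝ (fderiv ℝ fun z => (F : Amb p q → ℝ) (θ.1.1, z)) θ.2.1 θ.2.1 θ.2.1
      = fderiv ℝ (fderiv ℝ (F : Amb p q → ℝ)) (incl θ) (projQ (incl θ)) (projQ (incl θ)) := h2.2
  rw [h3, h7, h8, ← h6] at h
  rw [sphOpQ_apply, Submodule.coe_add, Submodule.coe_add, Submodule.coe_neg, Submodule.coe_smul,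
    Pi.add_apply, Pi.add_apply, Pi.neg_apply, Pi.smul_apply, h4, h5, h, smul_eq_mul]
  ring

theorem contMDiff_smoothFun (hΩ : Set.range (incl (p := p) (q := q)) ⊆ Ω) (F : smoothFun Ω) :
    ContMDiff ((𝓡 p).prod (𝓡 q)) 𝓘(ℝ, ℝ) ∞ ((F : Amb p q → ℝ) ∘ incl) := by
  have hi : ContMDiff ((𝓡 p).prod (𝓡 q)) 𝓘(ℝ, Amb p q) ∞ (incl (p := p) (q := q)) :=
    (contMDiff_coe_sph.comp contMDiff_fst).prodMk_space (contMDiff_coe_sph.comp contMDiff_snd)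
  exact fun θ => (contDiffAt_smoothFun F (hΩ ⟨θ, rfl⟩)).contMDiffAt.comp θ (hi θ)

end Slices

/-- `□ F` depends only on the germ of `F`. -/
theorem box_congr {F G : Amb p q → ℝ} {x : Amb p q} (h : F =ᶠ[nhds x] G) : box F x = box G x := by
  have hP : (fun y => F (y, x.2)) =ᶠ[nhds x.1] fun y => G (y, x.2) :=
    (hasFDerivAt_sliceP x.2 x.1).continuousAt.eventually h
  have hQ : (fun z => F (x.1, z)) =ᶠ[nhds x.2] fun z => G (x.1, z) :=
    (hasFDerivAt_sliceQ x.1 x.2).continuousAt.eventually h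
  rw [box, box, (InnerProductSpace.laplacian_congr_nhds hP).eq_of_nhds,
    (InnerProductSpace.laplacian_congr_nhds hQ).eq_of_nhds]

/-- An extension of `f` is, near the product of spheres, an eigenfunction `F` of the radial
vector field among the smooth functions on some open set. -/
theorem IsExtension.exists_smoothFun {w : ℝ} {f : Sph p × Sph q → ℝ} {F : Amb p q → ℝ}
    (h : IsExtension w f F) :
    ∃ (Ω : Opens (Amb p q)) (G : smoothFun Ω), Set.range (incl (p := p) (q := q)) ⊆ Ω ∧
      f = (G : Amb p q → ℝ) ∘ incl ∧ linDeriv projQ G = w • G - linDeriv projP G ∧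
      (∀ θ, box F (incl θ)
        = ((sumSqDeriv unitP G - sumSqDeriv unitQ G : smoothFun Ω) : Amb p q → ℝ) (incl θ)) ∧
      ∀ θ, box (box F) (incl θ)
        = ((sumSqDeriv unitP (sumSqDeriv unitP G - sumSqDeriv unitQ G)
          - sumSqDeriv unitQ (sumSqDeriv unitP G - sumSqDeriv unitQ G) : smoothFun Ω) :
            Amb p q → ℝ) (incl θ) := by
  obtain ⟨hf, U, hU, hMU, hF, hX⟩ := h
  let Ω : Opens (Amb p q) := ⟨U, hU⟩
  let G : smoothFun Ω := restrictSmooth F hF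
  have hG : ∀ x ∈ Ω, (G : Amb p q → ℝ) x = F x := fun x hx => restrictSmooth_apply hF hx
  have hGF : ∀ x ∈ Ω, F =ᶠ[nhds x] (G : Amb p q → ℝ) := fun x hx =>
    Filter.mem_of_superset (Ω.isOpen.mem_nhds hx) fun y hy => (hG y hy).symm
  have hb : ∀ x ∈ Ω, box F x
      = ((sumSqDeriv unitP G - sumSqDeriv unitQ G : smoothFun Ω) : Amb p q → ℝ) x :=
    fun x hx => by rw [box_congr (hGF x hx), box_smoothFun G hx]
  refine ⟨Ω, G, hMU, ?_, ?_, fun θ => hb _ (hMU ⟨θ, rfl⟩), fun θ => ?_⟩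
  · funext θ
    rw [Function.comp_apply, hG _ (hMU ⟨θ, rfl⟩), hf]
  · refine smoothFun_ext fun x hx => ?_
    have hx' := hX x hx
    rw [radR, radS, (hGF x hx).fderiv_eq] at hx'
    rw [Submodule.coe_sub, Submodule.coe_smul, Pi.sub_apply, Pi.smul_apply, smul_eq_mul, hG x hx,
      ← hx']
    change (lieDeriv _ _ G : Amb p q → ℝ) x = _ - (lieDeriv _ _ G : Amb p q → ℝ) x
    rw [lieDeriv_apply _ G hx, lieDeriv_apply _ G hx]
    change fderiv ℝ (G : Amb p q → ℝ) x (0, x.2) = _ - fderiv ℝ (G : Amb p q → ℝ) x (x.1, 0)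
    ring
  · have hx : incl θ ∈ Ω := hMU ⟨θ, rfl⟩
    -- `□ F` agrees with the operator applied to `G` near `incl θ`, so `□` may be applied again.
    have he : box F =ᶠ[nhds (incl θ)]
        ((sumSqDeriv unitP G - sumSqDeriv unitQ G : smoothFun Ω) : Amb p q → ℝ) :=
      Filter.mem_of_superset (Ω.isOpen.mem_nhds hx) fun y hy => hb y hy
    rw [box_congr he, box_smoothFun _ hx]

/-! ### Homogeneous extensions -/

/-- The point of the unit sphere in the direction of `w`, with an arbitrary value at `w = 0`. -/
def direction {n : ℕ} (w : EuclideanSpace ℝ (Fin (n + 1))) : Sph n :=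
  if h : w = 0 then ⟨EuclideanSpace.single 0 1, by simp⟩
  else ⟨‖w‖⁻¹ • w, by simp [norm_smul, h]⟩

theorem coe_direction {n : ℕ} {w : EuclideanSpace ℝ (Fin (n + 1))} (hw : w ≠ 0) :
    (direction w : EuclideanSpace ℝ (Fin (n + 1))) = ‖w‖⁻¹ • w := by
  simp [direction, hw]

theorem direction_coe {n : ℕ} (x : Sph n) : direction (x : EuclideanSpace ℝ (Fin (n + 1))) = x := by
  refine Subtype.ext ?_
  rw [coe_direction (ne_zero_of_mem_unit_sphere x), norm_eq_of_mem_sphere x]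
  simp

theorem direction_smul {n : ℕ} {t : ℝ} (ht : 0 < t) {w : EuclideanSpace ℝ (Fin (n + 1))}
    (hw : w ≠ 0) : direction (t • w) = direction w := by
  refine Subtype.ext ?_
  rw [coe_direction hw, coe_direction (smul_ne_zero ht.ne' hw), norm_smul,
    Real.norm_of_nonneg ht.le, smul_smul]
  congr 1
  field_simp

theorem contMDiffAt_direction {n : ℕ} {w : EuclideanSpace ℝ (Fin (n + 1))} (hw : w ≠ 0) :
    ContMDiffAt 𝓘(ℝ, EuclideanSpace ℝ (Fin (n + 1))) (𝓡 n) ∞ direction w := by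
  have := Fact.mk (@finrank_euclideanSpace_fin ℝ _ (n + 1))
  let U : Opens (EuclideanSpace ℝ (Fin (n + 1))) := ⟨{0}ᶜ, isOpen_compl_singleton⟩
  have hs : ContMDiff 𝓘(ℝ, EuclideanSpace ℝ (Fin (n + 1)))
      𝓘(ℝ, EuclideanSpace ℝ (Fin (n + 1))) ∞
      (fun w : U => ‖(w : EuclideanSpace ℝ (Fin (n + 1)))‖⁻¹ •
        (w : EuclideanSpace ℝ (Fin (n + 1)))) := fun w =>
    contMDiffAt_subtype_iff.2 (((contDiffAt_norm ℝ w.2).inv (norm_ne_zero_iff.2 w.2)).smul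
      contDiffAt_id).contMDiffAt
  have hm : ∀ w : U, ‖(w : EuclideanSpace ℝ (Fin (n + 1)))‖⁻¹ •
      (w : EuclideanSpace ℝ (Fin (n + 1))) ∈ Metric.sphere (0 : EuclideanSpace ℝ (Fin (n + 1))) 1 :=
    fun w => by
      have : (w : EuclideanSpace ℝ (Fin (n + 1))) ≠ 0 := w.2
      simp [norm_smul, this]
  have hc := ContMDiff.codRestrict_sphere (n := n) hs hm ⟨w, hw⟩
  have he : (fun w : U => direction (w : EuclideanSpace ℝ (Fin (n + 1))))
      = Set.codRestrict _ _ hm :=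
    funext fun w => Subtype.ext (coe_direction w.2)
  rw [← he] at hc
  exact contMDiffAt_subtype_iff.1 hc

/-- The extension of `f` that is homogeneous of bidegree `(u, v)`. -/
def homogExt (u v : ℝ) (f : Sph p × Sph q → ℝ) (x : Amb p q) : ℝ :=
  ‖x.1‖ ^ u * ‖x.2‖ ^ v * f (direction x.1, direction x.2)

theorem contDiffAt_homogExt (u v : ℝ) {f : Sph p × Sph q → ℝ}
    (hf : ContMDiff ((𝓡 p).prod (𝓡 q)) 𝓘(ℝ, ℝ) ∞ f) {x : Amb p q} (h1 : x.1 ≠ 0) (h2 : x.2 ≠ 0) :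
    ContDiffAt ℝ ∞ (homogExt u v f) x := by
  have hd : ContMDiffAt 𝓘(ℝ, Amb p q) ((𝓡 p).prod (𝓡 q)) ∞
      (fun x : Amb p q => (direction x.1, direction x.2)) x :=
    ((contMDiffAt_direction h1).comp x contDiffAt_fst.contMDiffAt).prodMk
      ((contMDiffAt_direction h2).comp x contDiffAt_snd.contMDiffAt)
  have hn1 : ContDiffAt ℝ ∞ (fun x : Amb p q => ‖x.1‖ ^ u) x :=
    ((contDiffAt_norm ℝ h1).comp x contDiffAt_fst).rpow_const_of_ne (norm_ne_zero_iff.2 h1)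
  have hn2 : ContDiffAt ℝ ∞ (fun x : Amb p q => ‖x.2‖ ^ v) x :=
    ((contDiffAt_norm ℝ h2).comp x contDiffAt_snd).rpow_const_of_ne (norm_ne_zero_iff.2 h2)
  exact (hn1.mul hn2).mul ((hf _).comp x hd).contDiffAt

theorem radS_homogExt (u v : ℝ) {f : Sph p × Sph q → ℝ}
    (hf : ContMDiff ((𝓡 p).prod (𝓡 q)) 𝓘(ℝ, ℝ) ∞ f) {x : Amb p q} (h1 : x.1 ≠ 0) (h2 : x.2 ≠ 0) :
    radS (homogExt u v f) x = u * homogExt u v f x := by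
  -- Both sides of the homogeneity relation along the ray `t ↦ (t y, z)` are differentiated at
  -- `t = 1`.
  have hc : HasDerivAt (fun t : ℝ => ((t • x.1, x.2) : Amb p q)) (x.1, 0) 1 := by
    simpa using ((hasDerivAt_id (1 : ℝ)).smul_const x.1).prodMk (hasDerivAt_const (1 : ℝ) x.2)
  have hF : HasFDerivAt (homogExt u v f) (fderiv ℝ (homogExt u v f) x) ((1 : ℝ) • x.1, x.2) := by
    rw [one_smul]
    exact ((contDiffAt_homogExt u v hf h1 h2).differentiableAt (by simp)).hasFDerivAt
  have hl := hF.comp_hasDerivAt (1 : ℝ) hc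
  have hr : HasDerivAt (fun t : ℝ => t ^ u * homogExt u v f x) (u * homogExt u v f x) 1 := by
    simpa using (Real.hasDerivAt_rpow_const (p := u) (Or.inl (one_ne_zero (α := ℝ)))).mul_const
      (homogExt u v f x)
  have he : homogExt u v f ∘ (fun t : ℝ => ((t • x.1, x.2) : Amb p q))
      =ᶠ[nhds 1] fun t => t ^ u * homogExt u v f x := by
    filter_upwards [lt_mem_nhds (zero_lt_one' ℝ)] with t ht
    simp only [homogExt, Function.comp_apply, direction_smul ht h1, norm_smul,
      Real.norm_of_nonneg ht.le, Real.mul_rpow ht.le (norm_nonneg _)]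
    ring
  exact hl.unique (hr.congr_of_eventuallyEq he)

theorem radR_homogExt (u v : ℝ) {f : Sph p × Sph q → ℝ}
    (hf : ContMDiff ((𝓡 p).prod (𝓡 q)) 𝓘(ℝ, ℝ) ∞ f) {x : Amb p q} (h1 : x.1 ≠ 0) (h2 : x.2 ≠ 0) :
    radR (homogExt u v f) x = v * homogExt u v f x := by
  have hc : HasDerivAt (fun t : ℝ => ((x.1, t • x.2) : Amb p q)) (0, x.2) 1 := by
    simpa using (hasDerivAt_const (1 : ℝ) x.1).prodMk ((hasDerivAt_id (1 : ℝ)).smul_const x.2)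
  have hF : HasFDerivAt (homogExt u v f) (fderiv ℝ (homogExt u v f) x) (x.1, (1 : ℝ) • x.2) := by
    rw [one_smul]
    exact ((contDiffAt_homogExt u v hf h1 h2).differentiableAt (by simp)).hasFDerivAt
  have hl := hF.comp_hasDerivAt (1 : ℝ) hc
  have hr : HasDerivAt (fun t : ℝ => t ^ v * homogExt u v f x) (v * homogExt u v f x) 1 := by
    simpa using (Real.hasDerivAt_rpow_const (p := v) (Or.inl (one_ne_zero (α := ℝ)))).mul_const
      (homogExt u v f x)
  have he : homogExt u v f ∘ (fun t : ℝ => ((x.1, t • x.2) : Amb p q))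
      =ᶠ[nhds 1] fun t => t ^ v * homogExt u v f x := by
    filter_upwards [lt_mem_nhds (zero_lt_one' ℝ)] with t ht
    simp only [homogExt, Function.comp_apply, direction_smul ht h2, norm_smul,
      Real.norm_of_nonneg ht.le, Real.mul_rpow ht.le (norm_nonneg _)]
    ring
  exact hl.unique (hr.congr_of_eventuallyEq he)

theorem isExtension_homogExt (u v : ℝ) {f : Sph p × Sph q → ℝ}
    (hf : ContMDiff ((𝓡 p).prod (𝓡 q)) 𝓘(ℝ, ℝ) ∞ f) : IsExtension (u + v) f (homogExt u v f) := by
  refine ⟨fun θ => ?_, {x | x.1 ≠ 0 ∧ x.2 ≠ 0}, ?_, ?_, ?_, ?_⟩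
  · simp [homogExt, incl, direction_coe]
  · exact (isOpen_ne_fun continuous_fst continuous_const).inter
      (isOpen_ne_fun continuous_snd continuous_const)
  · rintro _ ⟨θ, rfl⟩
    exact ⟨ne_zero_of_mem_unit_sphere θ.1, ne_zero_of_mem_unit_sphere θ.2⟩
  · exact fun x hx => (contDiffAt_homogExt u v hf hx.1 hx.2).contDiffWithinAt
  · intro x hx
    rw [radR_homogExt u v hf hx.1 hx.2, radS_homogExt u v hf hx.1 hx.2]
    ring

/-! ### The restrictions of `□` and `□²` -/

theorem box_eq {f : Sph p × Sph q → ℝ} {F : Amb p q → ℝ}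
    (h : IsExtension (1 - ((p : ℝ) + q) / 2) f F) (θ : Sph p × Sph q) :
    box F (incl θ) = lapQ f θ - lapP f θ
      - ((q : ℝ) - p) / 2 * (1 - ((p : ℝ) + q) / 2) * f θ := by
  obtain ⟨Ω, G, hΩ, rfl, hX, hb, -⟩ := h.exists_smoothFun
  rw [hb, lapQ_smoothFun hΩ, lapP_smoothFun hΩ,
    box_identity sphOpP_apply sphOpQ_apply (linDeriv_comm projQ_projP) hX rfl]
  rfl

theorem box_box_eq {f : Sph p × Sph q → ℝ} {F : Amb p q → ℝ}
    (h : IsExtension (2 - ((p : ℝ) + q) / 2) f F) {κ : ℝ}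
    (hκ : κ = ((p : ℝ) + q - 2) * ((q : ℝ) - p) / 4) (θ : Sph p × Sph q) :
    box (box F) (incl θ)
      = lapQ (lapQ f) θ + lapP (lapP f) θ - 2 * lapQ (lapP f) θ
        - 2 * (1 - κ) * lapQ f θ + 2 * (-1 - κ) * lapP f θ
        + (κ ^ 2 + ((p : ℝ) + q) - ((p : ℝ) + q) ^ 2 / 2 + p * q) * f θ := by
  obtain ⟨Ω, G, hΩ, rfl, hX, -, hb⟩ := h.exists_smoothFun
  have hP : ∀ H : smoothFun Ω, lapP ((H : Amb p q → ℝ) ∘ incl)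
      = ((sphOpP H : smoothFun Ω) : Amb p q → ℝ) ∘ incl :=
    fun H => funext (lapP_smoothFun hΩ H)
  have hQ : ∀ H : smoothFun Ω, lapQ ((H : Amb p q → ℝ) ∘ incl)
      = ((sphOpQ H : smoothFun Ω) : Amb p q → ℝ) ∘ incl :=
    fun H => funext (lapQ_smoothFun hΩ H)
  rw [hb, box_box_identity sphOpP_apply sphOpQ_apply (linDeriv_comm projQ_projP)
    (linDeriv_sumSqDeriv_of_eq_self fun _ => rfl) (linDeriv_sumSqDeriv_of_eq_self fun _ => rfl)
    (linDeriv_sumSqDeriv_of_eq_zero fun _ => rfl) (sumSqDeriv_comm _ _) hX rfl hκ]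
  simp only [hP, hQ]
  rfl

/-- The two expressions for `□²` agree, because the Laplacians of the factors commute. -/
theorem paneitz_prodMetric (h3 : 3 ≤ p + q) {f : Sph p × Sph q → ℝ} {w : ℝ} {F : Amb p q → ℝ}
    (hf : ContMDiff ((𝓡 p).prod (𝓡 q)) 𝓘(ℝ, ℝ) ∞ f) (h : IsExtension w f F)
    (θ : Sph p × Sph q) {κ : ℝ} (hκ : κ = ((p : ℝ) + q - 2) * ((q : ℝ) - p) / 4) :
    paneitz ((𝓡 p).prod (𝓡 q)) (prodBasis p q) (prodMetric p q) f θ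
      = lapQ (lapQ f) θ + lapP (lapP f) θ - 2 * lapQ (lapP f) θ
        - 2 * (1 - κ) * lapQ f θ + 2 * (-1 - κ) * lapP f θ
        + (κ ^ 2 + ((p : ℝ) + q) - ((p : ℝ) + q) ^ 2 / 2 + p * q) * f θ := by
  obtain ⟨Ω, G, hΩ, rfl, -, -, -⟩ := h.exists_smoothFun
  have hP : ∀ H : smoothFun Ω, lapP ((H : Amb p q → ℝ) ∘ incl)
      = ((sphOpP H : smoothFun Ω) : Amb p q → ℝ) ∘ incl :=
    fun H => funext (lapP_smoothFun hΩ H)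
  have hQ : ∀ H : smoothFun Ω, lapQ ((H : Amb p q → ℝ) ∘ incl)
      = ((sphOpQ H : smoothFun Ω) : Amb p q → ℝ) ∘ incl :=
    fun H => funext (lapQ_smoothFun hΩ H)
  have hL : ∀ H : smoothFun Ω, laplacian ((𝓡 p).prod (𝓡 q)) (prodBasis p q) (prodMetric p q)
      ((H : Amb p q → ℝ) ∘ incl) = ((sphOpQ H - sphOpP H : smoothFun Ω) : Amb p q → ℝ) ∘ incl :=
    fun H => funext fun θ => by
      rw [laplacian_prodMetric (contMDiff_smoothFun hΩ H), hP, hQ]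
      rfl
  have hc : sphOpP (sphOpQ G) = sphOpQ (sphOpP G) :=
    sphOp_comm_of_relations sphOpP_apply sphOpQ_apply (linDeriv_comm projQ_projP)
      (linDeriv_sumSqDeriv_of_eq_zero fun _ => rfl) (linDeriv_sumSqDeriv_of_eq_zero fun _ => rfl)
      (sumSqDeriv_comm _ _) G
  rw [paneitz, codiff_paneitzT_diff h3 hf, paneitzQ_prodMetric h3, dim_prodBasis,
    hL, hL]
  simp only [hP, hQ, map_sub, hc, Function.comp_apply, Submodule.coe_sub, Pi.sub_apply]
  subst hκ
  ring

end SphereProduct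

end
open PseudoRiem SphereProduct in
theorem mainTheorem3 (p q : ℕ) (n : ℝ) (hn : n = (p : ℝ) + q) (h2 : 2 ≤ p + q) :
    -- the scalar curvature and `J`
    (∀ θ : Sph p × Sph q,
      scal ((𝓡 p).prod (𝓡 q)) (prodBasis p q) (prodMetric p q) θ = (n - 1) * ((q : ℝ) - p) ∧
      schoutenJ ((𝓡 p).prod (𝓡 q)) (prodBasis p q) (prodMetric p q) θ = ((q : ℝ) - p) / 2) ∧
    -- extensions of `f` exist, even with prescribed bidegree of homogeneity
    (∀ (u v : ℝ) (f : Sph p × Sph q → ℝ), ContMDiff ((𝓡 p).prod (𝓡 q)) 𝓘(ℝ, ℝ) ∞ f →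
      ∃ F : Amb p q → ℝ, IsExtension (u + v) f F ∧
        ∀ x : Amb p q, x.1 ≠ 0 → x.2 ≠ 0 → radS F x = u * F x ∧ radR F x = v * F x) ∧
    -- `m = 1`
    (∀ f : Sph p × Sph q → ℝ, ContMDiff ((𝓡 p).prod (𝓡 q)) 𝓘(ℝ, ℝ) ∞ f →
      ∀ F : Amb p q → ℝ, IsExtension (1 - n / 2) f F → ∀ θ : Sph p × Sph q,
        box F (incl θ)
          = lapQ f θ - lapP f θ - ((q : ℝ) - p) / 2 * (1 - n / 2) * f θ ∧
        box F (incl θ) = yamabe ((𝓡 p).prod (𝓡 q)) (prodBasis p q) (prodMetric p q) f θ) ∧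
    -- `m = 2`: the explicit form
    (∀ f : Sph p × Sph q → ℝ, ContMDiff ((𝓡 p).prod (𝓡 q)) 𝓘(ℝ, ℝ) ∞ f →
      ∀ F : Amb p q → ℝ, IsExtension (2 - n / 2) f F → ∀ θ : Sph p × Sph q, ∀ κ : ℝ,
        κ = (n - 2) / (4 * (n - 1))
          * scal ((𝓡 p).prod (𝓡 q)) (prodBasis p q) (prodMetric p q) θ →
        box (box F) (incl θ)
          = lapQ (lapQ f) θ + lapP (lapP f) θ - 2 * lapQ (lapP f) θ
            - 2 * (1 - κ) * lapQ f θ + 2 * (-1 - κ) * lapP f θ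
            + (κ ^ 2 + n - n ^ 2 / 2 + p * q) * f θ) ∧
    -- `m = 2`: the Paneitz operator, with the explicit forms of its parts
    (3 ≤ p + q →
      (∀ θ : Sph p × Sph q,
        normSq ((𝓡 p).prod (𝓡 q)) (prodBasis p q) (prodMetric p q)
          (schoutenV ((𝓡 p).prod (𝓡 q)) (prodBasis p q) (prodMetric p q)) θ = n / 4 ∧
        paneitzQ ((𝓡 p).prod (𝓡 q)) (prodBasis p q) (prodMetric p q) θ
          = n / 2 * (((q : ℝ) - p) / 2) ^ 2 - n / 2) ∧
      ∀ f : Sph p × Sph q → ℝ, ContMDiff ((𝓡 p).prod (𝓡 q)) 𝓘(ℝ, ℝ) ∞ f →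
        (∀ θ : Sph p × Sph q,
          codiff ((𝓡 p).prod (𝓡 q)) (prodBasis p q) (prodMetric p q)
            (paneitzT ((𝓡 p).prod (𝓡 q)) (prodBasis p q) (prodMetric p q)
              (diff ((𝓡 p).prod (𝓡 q)) f)) θ
            = (n - 2) * (((q : ℝ) - p) / 2) * (lapQ f θ - lapP f θ)
              - 2 * (lapQ f θ + lapP f θ)) ∧
        ∀ F : Amb p q → ℝ, IsExtension (2 - n / 2) f F → ∀ θ : Sph p × Sph q,
          box (box F) (incl θ)
            = paneitz ((𝓡 p).prod (𝓡 q)) (prodBasis p q) (prodMetric p q) f θ) := by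
  subst hn
  have h2' : (2 : ℝ) ≤ p + q := by exact_mod_cast h2
  have hn1 : (p : ℝ) + q - 1 ≠ 0 := by linarith
  refine ⟨fun θ => ⟨scal_prodMetric θ, schoutenJ_prodMetric h2 θ⟩, fun u v f hf =>
    ⟨homogExt u v f, isExtension_homogExt u v hf, fun x h1 h2 =>
      ⟨radS_homogExt u v hf h1 h2, radR_homogExt u v hf h1 h2⟩⟩,
    fun f hf F hF θ => ⟨box_eq hF θ, ?_⟩, fun f hf F hF θ κ hκ => box_box_eq hF ?_ θ,
    fun h3 => ⟨fun θ => ⟨normSq_schoutenV h3 θ, paneitzQ_prodMetric h3 θ⟩, fun f hf =>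
      ⟨codiff_paneitzT_diff h3 hf, fun F hF θ =>
        (box_box_eq hF rfl θ).trans (paneitz_prodMetric h3 hf hF θ rfl).symm⟩⟩⟩
  · rw [box_eq hF, yamabe, laplacian_prodMetric hf, scal_prodMetric, dim_prodBasis]
    field_simp
    ring
  · rw [hκ, scal_prodMetric]
    field_simp
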